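/- **Setting.** Fix an infinite one-dimensional array of intervals (resonators), $L$-periodic, with $N$ resonators per unit cell: $D_i^m=(x_i^-+mL,\,x_i^++mL)$, $1\le i\le N$, $m\in\mathbb Z$, with $D_i^0\subset(0,L)$, lengths $\ell_i=x_i^+-x_i^-$, and disjoint closures. For $\alpha\in\mathbb R$ let $V_j^\alpha$ be the continuous function with $V''=0$ off the closed resonators, $V=\delta_{ij}$ on $D_i^0$, and $V(x+mL)=e^{i\alpha mL}V(x)$. Put $C^\alpha_{ij}=\frac{dV_j^\alpha}{dx}\big|_-(x_i^-)-\frac{dV_j^\alpha}{dx}\big|_+(x_i^+)$. The material has background parameters $\rho_0,\kappa_0>0$, unperturbed resonator parameters $\rho_r,\kappa_r>0$, perturbed densities $\rho_r^{m,i}>0$ in $D_i^m$, and boundary contrasts $\delta_i^m>0$. Put $\delta=\rho_r/\rho_0$, $v_0^2=\kappa_0/\rho_0$, $v_r^2=\kappa_r/\rho_r$, $(v_i^m)^2=\kappa_r/\rho_r^{m,i}$, and define $b_i^m$ by $\delta_i^m(v_i^m)^2=\delta v_r^2b_i^m$. The real nonvanishing functions $s_i$ and $\kappa_i^p$ have reciprocals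 $1/s_i(t)=\sum_{|n|\le M}s_{i,n}e^{in\Omega t}$ and $1/\kappa_i^p(t)=\sum_{|n|\le M}k_{i,n}e^{in\Omega t}$, $\Omega>0$, and the modulation with a time defect is $1/\kappa_i(t)=1/\kappa_i^p(t)+c_if(t)$ with $f\in C^1\cap L^1(\mathbb R)$ real and $c_i\in\mathbb R$. Put $$B^m=\mathrm{diag}(b_i^m),\quad S=\mathrm{diag}(s_i),\quad K=\mathrm{diag}(\kappa_i^p),\quad \widetilde C=\mathrm{diag}(c_if),$$ $$\mathcal C^\alpha=\frac{\delta\kappa_r}{\rho_r}\,\mathrm{diag}(1/\ell_i)\,C^\alpha,\qquad \mathcal C^k=\frac{L}{2\pi}\int_{-\pi/L}^{\pi/L}\mathcal C^\alpha e^{-i\alpha kL}\,d\alpha\quad(k\in\mathbb Z).$$ A *localised solution* is a field $u(x,t)=\int_{\mathbb R}v(x,\omega)e^{i\omega t}\,d\omega$, with $v$ measurable and $\omega^kv(x,\cdot)\in L^1$ for all $x$ and $k=0,1,2$, such that $u(\cdot,t)\in L^2(\mathbb R)$ for every $t$, $u(\cdot,t)$ is $C^2$ in the interior of each resonator and of each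 gap, $\partial_t^2u=v_0^2\partial_x^2u$ in the gaps, $\partial_t\big(\tfrac1{\kappa_i}\partial_tu\big)=(v_i^m)^2\partial_x^2u$ in $D_i^m$, and on the boundary of $D_i^m$ the one-sided limits exist and satisfy $u|_{\rm out}=\tfrac1{s_i}u|_{\rm in}$ and $\delta_i^m\,\partial_xu|_{\rm out}=\tfrac1{s_i}\partial_xu|_{\rm in}$. Let $v_i^m(\omega)$ be the mean of $v(\cdot,\omega)$ over $D_i^m$, and $\mathbf u^m(t)=\int_{\mathbb R}\mathbf v^m(\omega)e^{i\omega t}\,d\omega$ with $\mathbf v^m=(v_i^m)_{i=1}^N$. **Proposition.** Let $0<\gamma<1$ and $A\ge1$. There is a constant $\mathsf K>0$, depending only on $A$, $\gamma$ and the geometry, with the following property. Suppose that $\delta<1$, that $v_0,v_r,v_i^m,\delta_i^m/\delta\in[A^{-1},A]$ for all $m,i$, that $\Omega\le A\delta^{1/2}$ and $M\le A\delta^{-\gamma/2}$, and that $\sum_n|s_{i,n}|$, $\sum_n|k_{i,n}|$, $\sup|s_i|$, $|c_i|$, $\sup|f|$, $\sup|f'|$ are at most $A$. Let $u$ be a localised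 solution that is subwavelength, in the sense that $\int_{\mathbb R}|\omega|^k|v(x,\omega)|\,d\omega\le A\,\delta^{k(1-\gamma)/2}$ for all $x$ and $k=0,1,2$. Then for every $m\in\mathbb Z$ and $t\in\mathbb R$: 1. $|u(x,t)-u_i^m(t)|\le\mathsf K\,\delta^{(1-\gamma)/2}$ for all $i$ and $x\in D_i^m$. 2. $\mathbf u^m$ and $(K^{-1}+\widetilde C)\frac{d}{dt}\mathbf u^m$ are differentiable at $t$, the series below converges, and the real-space capacitance formulation holds to leading order in $\delta$ (its terms are of order $\delta$): $$\Big\|\,B^m\sum_{n\in\mathbb Z}\mathcal C^{\,n-m}S^{-1}(t)\,\mathbf u^n(t)+S^{-1}(t)\frac{d}{dt}\Big(\big(K^{-1}(t)+\widetilde C(t)\big)\frac{d}{dt}\mathbf u^m(t)\Big)\Big\|_\infty\le\mathsf K\,\delta^{1+(1-\gamma)/2}.$$ -/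

import Mathlib

open Filter Topology MeasureTheory

noncomputable section

namespace SpaceTime

/-- An infinite one-dimensional array of resonators with `N` resonators per unit cell `(0, L)`.
Resonator number `k : ℤ` is the interval `(xm k, xp k)`; the boundary points are strictly increasing
and satisfy `x_{k+N} = x_k + L`. The central cell holds the resonators `0, …, N - 1`. -/
structure Chain (N : ℕ) where
  L : ℝ
  xm : ℤ → ℝ
  xp : ℤ → ℝ
  L_pos : 0 < L
  xm_lt_xp : ∀ k, xm k < xp k
  xp_lt_xm : ∀ k, xp k < xm (k + 1)
  xm_add : ∀ k, xm (k + N) = xm k + L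
  xp_add : ∀ k, xp (k + N) = xp k + L
  xm_zero_nonneg : 0 ≤ xm 0
  xp_last_le : xp ((N : ℤ) - 1) ≤ L

/-- The number, along the whole array, of the `i`-th resonator of the `m`-th cell. -/
def idx {N : ℕ} (m : ℤ) (i : Fin N) : ℤ := m * N + (i : ℕ)

namespace Chain

variable {N : ℕ}

/-- The resonator `D_i^m`. -/
def D (G : Chain N) (m : ℤ) (i : Fin N) : Set ℝ := Set.Ioo (G.xm (idx m i)) (G.xp (idx m i))

/-- The gap between the resonators number `k` and `k + 1` of the array. -/
def gap (G : Chain N) (k : ℤ) : Set ℝ := Set.Ioo (G.xp k) (G.xm (k + 1))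

/-- The length `ℓ_i` of the `i`-th resonator of each cell. -/
def len (G : Chain N) (i : Fin N) : ℝ := G.xp (idx 0 i) - G.xm (idx 0 i)

/-- The operator `I_{∂D_i}[h] = h'|_-(x_i^-) - h'|_+(x_i^+)` (one-sided limits of the derivative). -/
def bdryFlux (G : Chain N) (i : Fin N) (h : ℝ → ℂ) : ℂ :=
  Function.leftLim (deriv h) (G.xm (idx 0 i)) - Function.rightLim (deriv h) (G.xp (idx 0 i))

/-- The boundary value problem for `V_j^α`: continuous, harmonic off the resonators, equal to `δ_{ij}`
on `D_i` for every resonator of the central cell, and `α`-quasiperiodic. -/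
structure IsPotential (G : Chain N) (α : ℝ) (j : Fin N) (V : ℝ → ℂ) : Prop where
  continuous : Continuous V
  smooth : ∀ k, ContDiffOn ℝ 2 V (G.gap k)
  harmonic : ∀ k, ∀ x ∈ G.gap k, deriv (deriv V) x = 0
  on_resonator : ∀ i, ∀ x ∈ G.D 0 i, V x = if i = j then 1 else 0
  quasiperiodic : ∀ (x : ℝ) (m : ℤ),
    V (x + m * G.L) = Complex.exp (Complex.I * α * m * G.L) * V x

/-- The solution `V_j^α` of this problem (it is unique). -/
def potential (G : Chain N) (α : ℝ) (j : Fin N) : ℝ → ℂ :=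
  Classical.epsilon (G.IsPotential α j)

/-- The quasiperiodic capacitance matrix `C^α`, `C^α_{ij} = I_{∂D_i}[V_j^α]`. -/
def capMatrix (G : Chain N) (α : ℝ) : Matrix (Fin N) (Fin N) ℂ :=
  Matrix.of fun i j => G.bdryFlux i (G.potential α j)

/-- The inverse Floquet–Bloch transform
`(L / 2π) ∫_{-π/L}^{π/L} F(α) exp(-i α m L) dα` at the lattice point `m L`, entry by entry. -/
def invBloch (G : Chain N) (F : ℝ → Matrix (Fin N) (Fin N) ℂ) (m : ℤ) :
    Matrix (Fin N) (Fin N) ℂ :=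
  Matrix.of fun i j => ((G.L / (2 * Real.pi) : ℝ) : ℂ) *
    ∫ α in (-(Real.pi / G.L))..(Real.pi / G.L),
      F α i j * Complex.exp (-(Complex.I * α * m * G.L))

end Chain

/-- The material parameters of the structure with a defect in space and a defect in time.
* `ρ0, κ0`: background; `ρr, κr`: resonators of the unperturbed structure;
* `ρd m i`: density `ρ_r^{m,i}` of the resonator `D_i^m`;
* `contrast m i`: contrast `δ^m` in the transmission condition on the boundary of `D_i^m`;
* `s i`: boundary sources; `κp i`: the time-periodic part of the modulation of the bulk modulus,
  whose reciprocals are trigonometric polynomials of degree `M` with base frequency `Ω`;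
* `c i`, `f`: the defect in time, `1 / κ_i = 1 / κp i + c i * f`. -/
structure Material (N : ℕ) where
  ρ0 : ℝ
  κ0 : ℝ
  ρr : ℝ
  κr : ℝ
  ρd : ℤ → Fin N → ℝ
  contrast : ℤ → Fin N → ℝ
  Ω : ℝ
  M : ℕ
  sHat : Fin N → ℤ → ℂ
  kHat : Fin N → ℤ → ℂ
  s : Fin N → ℝ → ℝ
  κp : Fin N → ℝ → ℝ
  c : Fin N → ℝ
  f : ℝ → ℝ
  ρ0_pos : 0 < ρ0
  κ0_pos : 0 < κ0
  ρr_pos : 0 < ρr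
  κr_pos : 0 < κr
  ρd_pos : ∀ m i, 0 < ρd m i
  contrast_pos : ∀ m i, 0 < contrast m i
  Ω_pos : 0 < Ω
  s_ne_zero : ∀ i t, s i t ≠ 0
  κp_ne_zero : ∀ i t, κp i t ≠ 0
  inv_s_eq : ∀ i t, (((s i t)⁻¹ : ℝ) : ℂ) =
    ∑ n ∈ Finset.Icc (-(M : ℤ)) M, sHat i n * Complex.exp (Complex.I * n * Ω * t)
  inv_κp_eq : ∀ i t, (((κp i t)⁻¹ : ℝ) : ℂ) =
    ∑ n ∈ Finset.Icc (-(M : ℤ)) M, kHat i n * Complex.exp (Complex.I * n * Ω * t)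
  f_contDiff : ContDiff ℝ 1 f
  f_integrable : Integrable f

namespace Material

variable {N : ℕ}

/-- The contrast `δ = ρ_r / ρ_0`. -/
def δ (P : Material N) : ℝ := P.ρr / P.ρ0

/-- The background wave speed. -/
def v0 (P : Material N) : ℝ := Real.sqrt (P.κ0 / P.ρ0)

/-- The wave speed in the resonators of the unperturbed structure. -/
def vr (P : Material N) : ℝ := Real.sqrt (P.κr / P.ρr)

/-- The wave speed `v_i^m` in the resonator `D_i^m`. -/
def vd (P : Material N) (m : ℤ) (i : Fin N) : ℝ := Real.sqrt (P.κr / P.ρd m i)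

/-- `1 / κ_i(t) = 1 / κ_i^p(t) + c_i f(t)`. -/
def invκ (P : Material N) (i : Fin N) (t : ℝ) : ℝ := (P.κp i t)⁻¹ + P.c i * P.f t

/-- `b_i^m`, determined by `δ^m (v_i^m)² = δ v_r² b_i^m`. -/
def b (P : Material N) (m : ℤ) (i : Fin N) : ℝ :=
  P.contrast m i * P.vd m i ^ 2 / (P.δ * P.vr ^ 2)

/-- `B^m = diag(b_i^m)`. -/
def matB (P : Material N) (m : ℤ) : Matrix (Fin N) (Fin N) ℂ :=
  Matrix.diagonal fun i => (P.b m i : ℂ)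

/-- `S(t) = diag(s_i(t))`. -/
def matS (P : Material N) (t : ℝ) : Matrix (Fin N) (Fin N) ℂ :=
  Matrix.diagonal fun i => (P.s i t : ℂ)

/-- `K(t) = diag(κ_i^p(t))`. -/
def matK (P : Material N) (t : ℝ) : Matrix (Fin N) (Fin N) ℂ :=
  Matrix.diagonal fun i => (P.κp i t : ℂ)

/-- `C̃(t) = diag(c_i f(t))`. -/
def matCt (P : Material N) (t : ℝ) : Matrix (Fin N) (Fin N) ℂ :=
  Matrix.diagonal fun i => ((P.c i * P.f t : ℝ) : ℂ)

/-- The generalised capacitance matrix `𝒞^α = (δ κ_r / ρ_r) diag(1 / ℓ_i) C^α`. -/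
def genCap (P : Material N) (G : Chain N) (α : ℝ) : Matrix (Fin N) (Fin N) ℂ :=
  ((P.δ * P.κr / P.ρr : ℝ) : ℂ) •
    (Matrix.diagonal (fun i => (((G.len i)⁻¹ : ℝ) : ℂ)) * G.capMatrix α)

/-- The real-space generalised capacitance matrix `𝒞^m`. -/
def realCap (P : Material N) (G : Chain N) (m : ℤ) : Matrix (Fin N) (Fin N) ℂ :=
  G.invBloch (P.genCap G) m

/-- The high-contrast regime, with all implicit constants bounded by `A`: wave speeds of order one,
all contrasts of order `δ`, modulation with `Ω = O(δ^{1/2})` and `M = O(δ^{-γ/2})`, and modulations,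
sources and time defect of order one. -/
structure InRegime (P : Material N) (γ A : ℝ) : Prop where
  δ_lt_one : P.δ < 1
  v0_mem : P.v0 ∈ Set.Icc A⁻¹ A
  vr_mem : P.vr ∈ Set.Icc A⁻¹ A
  vd_mem : ∀ m i, P.vd m i ∈ Set.Icc A⁻¹ A
  contrast_mem : ∀ m i, P.contrast m i / P.δ ∈ Set.Icc A⁻¹ A
  Ω_le : P.Ω ≤ A * P.δ ^ (1 / 2 : ℝ)
  M_le : (P.M : ℝ) ≤ A * P.δ ^ (-γ / 2)
  sHat_le : ∀ i, ∑ n ∈ Finset.Icc (-(P.M : ℤ)) P.M, ‖P.sHat i n‖ ≤ A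
  kHat_le : ∀ i, ∑ n ∈ Finset.Icc (-(P.M : ℤ)) P.M, ‖P.kHat i n‖ ≤ A
  s_le : ∀ i t, |P.s i t| ≤ A
  c_le : ∀ i, |P.c i| ≤ A
  f_le : ∀ t, |P.f t| ≤ A
  deriv_f_le : ∀ t, |deriv P.f t| ≤ A

end Material

/-- The inverse Fourier transform in time, `t ↦ ∫ w(ω) exp(i ω t) dω`. -/
def invFourier (w : ℝ → ℂ) (t : ℝ) : ℂ :=
  ∫ ω, w ω * Complex.exp (Complex.I * ω * t)

/-- The wave field `u(x, t) = ∫ v(x, ω) exp(i ω t) dω`. -/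
def field (v : ℝ → ℝ → ℂ) (x t : ℝ) : ℂ := invFourier (v x) t

/-- The vector `𝐯^m(ω)`; `v_i^m(ω)` is the mean value of `v(·, ω)` over the resonator `D_i^m`. -/
def resMode {N : ℕ} (G : Chain N) (v : ℝ → ℝ → ℂ) (m : ℤ) (ω : ℝ) : Fin N → ℂ :=
  fun i => ((G.len i : ℝ) : ℂ)⁻¹ * ∫ x in G.D m i, v x ω

/-- The vector `𝐮^m(t) = ∫ 𝐯^m(ω) exp(i ω t) dω`. -/
def resField {N : ℕ} (G : Chain N) (v : ℝ → ℝ → ℂ) (m : ℤ) (t : ℝ) : Fin N → ℂ :=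
  fun i => invFourier (fun ω => resMode G v m ω i) t

/-- Transmission condition `d * h|_-(a) = r * h|_+(a)` at the left end `a` of a resonator
(outer limit from the left, inner limit from the right; both exist). -/
def JumpLeft (h : ℝ → ℂ) (a : ℝ) (d r : ℂ) : Prop :=
  ∃ o i : ℂ, Tendsto h (𝓝[<] a) (𝓝 o) ∧ Tendsto h (𝓝[>] a) (𝓝 i) ∧ d * o = r * i

/-- Transmission condition `d * h|_+(a) = r * h|_-(a)` at the right end `a` of a resonator. -/
def JumpRight (h : ℝ → ℂ) (a : ℝ) (d r : ℂ) : Prop :=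
  ∃ o i : ℂ, Tendsto h (𝓝[>] a) (𝓝 o) ∧ Tendsto h (𝓝[<] a) (𝓝 i) ∧ d * o = r * i

/-- `u(x, t) = ∫ v(x, ω) exp(i ω t) dω` is a classical solution of the wave transmission problem in
the infinite structure which is localised, that is, square integrable in space at each time. -/
structure IsLocalisedSolution {N : ℕ} (G : Chain N) (P : Material N) (v : ℝ → ℝ → ℂ) : Prop where
  measurable : Measurable (Function.uncurry v)
  integrable : ∀ x, ∀ k ≤ 2, Integrable fun ω : ℝ => (ω : ℂ) ^ k * v x ω
  smooth_out : ∀ t k, ContDiffOn ℝ 2 (fun x => field v x t) (G.gap k)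
  smooth_in : ∀ t m i, ContDiffOn ℝ 2 (fun x => field v x t) (G.D m i)
  wave_out : ∀ t k, ∀ x ∈ G.gap k,
    deriv (deriv (field v x)) t - (P.v0 : ℂ) ^ 2 * deriv (deriv fun y => field v y t) x = 0
  wave_in : ∀ t m i, ∀ x ∈ G.D m i,
    deriv (fun τ => (P.invκ i τ : ℂ) * deriv (field v x) τ) t
      - (P.vd m i : ℂ) ^ 2 * deriv (deriv fun y => field v y t) x = 0
  trace_left : ∀ t m i,
    JumpLeft (fun x => field v x t) (G.xm (idx m i)) 1 (((P.s i t)⁻¹ : ℝ) : ℂ)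
  trace_right : ∀ t m i,
    JumpRight (fun x => field v x t) (G.xp (idx m i)) 1 (((P.s i t)⁻¹ : ℝ) : ℂ)
  flux_left : ∀ t m i,
    JumpLeft (deriv fun x => field v x t) (G.xm (idx m i)) (P.contrast m i)
      (((P.s i t)⁻¹ : ℝ) : ℂ)
  flux_right : ∀ t m i,
    JumpRight (deriv fun x => field v x t) (G.xp (idx m i)) (P.contrast m i)
      (((P.s i t)⁻¹ : ℝ) : ℂ)
  localised : ∀ t, MemLp (fun x => field v x t) 2 volume

/-- The low-frequency (subwavelength) regime: `v(x, ·)` has size at most `A` in `L¹` and is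
concentrated at frequencies `ω = O(δ^{(1-γ)/2})`, measured by its first two moments. -/
def IsSubwavelength {N : ℕ} (P : Material N) (γ A : ℝ) (v : ℝ → ℝ → ℂ) : Prop :=
  ∀ x, ∀ k ≤ 2, ∫ ω : ℝ, |ω| ^ k * ‖v x ω‖ ≤ A * (P.δ ^ ((1 - γ) / 2)) ^ k

end SpaceTime

end

namespace SpaceTime

/-! Write `ε = δ^((1-γ)/2)` and freeze the time `t`. The moment bounds on `v` make `∂ₜu` of order
`ε` and `∂ₜ²u` of order `ε²`, so the wave equations make `∂ₓ²u` of order at most `ε` in gaps and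
resonators (`norm_deriv_deriv_gap_le`, `norm_deriv_deriv_resonator_le`). In a gap `u` is therefore
affine up to `O(ε)`, and its end slopes are the difference quotients of the outer traces `u/s`.
These slopes are bounded. Inside a resonator the slope is `s_i δ_i^m` times the outer one, hence
`O(δ)`, so `u` varies there by `O(ε)` only. This is the first claim (`Profile.norm_sub_le_of_mem`).

Averaging the wave equation over `D_i^m` expresses the time derivative term exactly by the jump of
the inner slopes, that is, by `s_i δ_i^m` times the jump of the outer slopes (`averaged_wave_in`).
Replacing traces by means, the latter jump is minus a nearest-neighbour difference operator
`laplace` applied to `u_i^m/s_i`, up to `O(ε)` (`Profile.norm_laplace_add_le`).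

On the capacitance side, `V_j^α` is piecewise linear, so `C^α` is the same operator applied to a
Bloch sequence (`capMatrix_apply`). The inverse Bloch transform of that sequence is a Kronecker
delta, so the series over `n` is a finite sum equal to `laplace` in real space (`hasSum_realCap`).
The two sides cancel, and the `O(ε)` error is multiplied by `δ_i^m (v_i^m)²/ℓ_i = O(δ)`. -/

/-! ### Nearly affine functions on an interval and their end slopes. -/

theorem norm_sub_le_of_norm_deriv_le_Ioo {h : ℝ → ℂ} {a b C : ℝ}
    (hd : ∀ x ∈ Set.Ioo a b, DifferentiableAt ℝ h x) (hC : ∀ x ∈ Set.Ioo a b, ‖deriv h x‖ ≤ C)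
    {x y : ℝ} (hx : x ∈ Set.Ioo a b) (hy : y ∈ Set.Ioo a b) : ‖h y - h x‖ ≤ C * (b - a) := by
  have h1 := (convex_Ioo a b).norm_image_sub_le_of_norm_deriv_le (𝕜 := ℝ) hd hC hx hy
  refine h1.trans (mul_le_mul_of_nonneg_left ?_ ((norm_nonneg _).trans (hC x hx)))
  rw [Real.norm_eq_abs, abs_le]
  constructor <;> linarith [hx.1, hx.2, hy.1, hy.2]

theorem norm_sub_left_le {h : ℝ → ℂ} {a b C : ℝ} {p : ℂ} (hab : a < b)
    (hC : ∀ x ∈ Set.Ioo a b, ∀ y ∈ Set.Ioo a b, ‖h y - h x‖ ≤ C)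
    (hp : Tendsto h (𝓝[>] a) (𝓝 p)) {y : ℝ} (hy : y ∈ Set.Ioo a b) : ‖h y - p‖ ≤ C := by
  refine le_of_tendsto (tendsto_const_nhds.sub hp).norm ?_
  filter_upwards [Ioo_mem_nhdsGT hab] with x hx using hC x hx y hy

theorem norm_sub_right_le {h : ℝ → ℂ} {a b C : ℝ} {p : ℂ} (hab : a < b)
    (hC : ∀ x ∈ Set.Ioo a b, ∀ y ∈ Set.Ioo a b, ‖h y - h x‖ ≤ C)
    (hp : Tendsto h (𝓝[<] b) (𝓝 p)) {y : ℝ} (hy : y ∈ Set.Ioo a b) : ‖h y - p‖ ≤ C := by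
  refine le_of_tendsto (tendsto_const_nhds.sub hp).norm ?_
  filter_upwards [Ioo_mem_nhdsLT hab] with x hx using hC x hx y hy

/-- If the derivative of `h` on `(a, b)` is within `C` of `p`, the difference of the one-sided
limits of `h` is within `C (b - a)` of `p (b - a)`. -/
theorem norm_sub_slope_le {h : ℝ → ℂ} {a b C : ℝ} {p ha hb : ℂ} (hab : a < b)
    (hd : ∀ x ∈ Set.Ioo a b, DifferentiableAt ℝ h x)
    (hC : ∀ x ∈ Set.Ioo a b, ‖deriv h x - p‖ ≤ C)
    (hl : Tendsto h (𝓝[>] a) (𝓝 ha)) (hr : Tendsto h (𝓝[<] b) (𝓝 hb)) :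
    ‖hb - ha - p * ((b - a : ℝ) : ℂ)‖ ≤ C * (b - a) := by
  have hof : ∀ x : ℝ, HasDerivAt (fun y : ℝ => p * (y : ℂ)) p x := fun x => by
    simpa using (Complex.ofRealCLM.hasDerivAt (x := x)).const_mul p
  have hc : Continuous fun y : ℝ => p * (y : ℂ) := by fun_prop
  have hd' : ∀ x ∈ Set.Ioo a b, HasDerivAt (fun y => h y - p * (y : ℂ)) (deriv h x - p) x :=
    fun x hx => (hd x hx).hasDerivAt.sub (hof x)
  have key : ∀ x ∈ Set.Ioo a b, ∀ y ∈ Set.Ioo a b,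
      ‖(h y - p * (y : ℂ)) - (h x - p * (x : ℂ))‖ ≤ C * (b - a) := fun x hx y hy =>
    norm_sub_le_of_norm_deriv_le_Ioo (h := fun y => h y - p * (y : ℂ))
      (fun x hx => (hd' x hx).differentiableAt)
      (fun x hx => by rw [(hd' x hx).deriv]; exact hC x hx) hx hy
  have h1 : ∀ y ∈ Set.Ioo a b, ‖(h y - p * (y : ℂ)) - (ha - p * (a : ℂ))‖ ≤ C * (b - a) :=
    fun y hy => norm_sub_left_le (h := fun y => h y - p * (y : ℂ)) hab key
      (hl.sub ((hc.tendsto a).mono_left nhdsWithin_le_nhds)) hy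
  have h2 : ‖(hb - p * (b : ℂ)) - (ha - p * (a : ℂ))‖ ≤ C * (b - a) := by
    refine le_of_tendsto (((hr.sub ((hc.tendsto b).mono_left nhdsWithin_le_nhds)).sub
      tendsto_const_nhds).norm) ?_
    filter_upwards [Ioo_mem_nhdsLT hab] with x hx using h1 x hx
  convert h2 using 2
  push_cast
  ring

theorem differentiableAt_of_contDiffOn_Ioo {h : ℝ → ℂ} {a b : ℝ}
    (hh : ContDiffOn ℝ 2 h (Set.Ioo a b)) {x : ℝ} (hx : x ∈ Set.Ioo a b) :
    DifferentiableAt ℝ h x :=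
  (hh.differentiableOn (by norm_num)).differentiableAt (isOpen_Ioo.mem_nhds hx)

theorem differentiableAt_deriv_of_contDiffOn_Ioo {h : ℝ → ℂ} {a b : ℝ}
    (hh : ContDiffOn ℝ 2 h (Set.Ioo a b)) {x : ℝ} (hx : x ∈ Set.Ioo a b) :
    DifferentiableAt ℝ (deriv h) x := by
  have h1 : ContDiffOn ℝ 1 (deriv h) (Set.Ioo a b) :=
    hh.deriv_of_isOpen isOpen_Ioo (by norm_num)
  exact (h1.differentiableOn (by norm_num)).differentiableAt (isOpen_Ioo.mem_nhds hx)

/-- A `C²` function whose second derivative is bounded by `C` has end slopes close to the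
difference quotient of its end values. -/
theorem norm_end_slopes_sub_le {h : ℝ → ℂ} {a b C : ℝ} {p q ha hb : ℂ} (hab : a < b)
    (hh : ContDiffOn ℝ 2 h (Set.Ioo a b))
    (hC : ∀ x ∈ Set.Ioo a b, ‖deriv (deriv h) x‖ ≤ C)
    (hl : Tendsto h (𝓝[>] a) (𝓝 ha)) (hr : Tendsto h (𝓝[<] b) (𝓝 hb))
    (hp : Tendsto (deriv h) (𝓝[>] a) (𝓝 p)) (hq : Tendsto (deriv h) (𝓝[<] b) (𝓝 q)) :
    ‖p - (hb - ha) / ((b - a : ℝ) : ℂ)‖ ≤ C * (b - a) ∧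
      ‖q - (hb - ha) / ((b - a : ℝ) : ℂ)‖ ≤ C * (b - a) := by
  -- The slope varies by at most `C (b - a)`, so it stays that close to either of its end limits `p`
  -- and `q`.
  have key : ∀ x ∈ Set.Ioo a b, ∀ y ∈ Set.Ioo a b, ‖deriv h y - deriv h x‖ ≤ C * (b - a) :=
    fun x hx y hy => norm_sub_le_of_norm_deriv_le_Ioo
      (fun x hx => differentiableAt_deriv_of_contDiffOn_Ioo hh hx) hC hx hy
  have hpos : 0 < b - a := sub_pos.2 hab
  have conv : ∀ r : ℂ, ‖hb - ha - r * ((b - a : ℝ) : ℂ)‖ ≤ C * (b - a) * (b - a) →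
      ‖r - (hb - ha) / ((b - a : ℝ) : ℂ)‖ ≤ C * (b - a) := by
    intro r hr
    have hne : ((b - a : ℝ) : ℂ) ≠ 0 := by exact_mod_cast hpos.ne'
    have e : r - (hb - ha) / ((b - a : ℝ) : ℂ)
        = -((hb - ha - r * ((b - a : ℝ) : ℂ)) / ((b - a : ℝ) : ℂ)) := by
      field_simp
      ring
    rw [e, norm_neg, norm_div, Complex.norm_real, Real.norm_of_nonneg hpos.le, div_le_iff₀ hpos]
    exact hr
  have hd := fun x hx => differentiableAt_of_contDiffOn_Ioo hh (x := x) hx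
  exact ⟨conv p (norm_sub_slope_le hab hd (fun x hx => norm_sub_left_le hab key hp hx) hl hr),
    conv q (norm_sub_slope_le hab hd (fun x hx => norm_sub_right_le hab key hq hx) hl hr)⟩

/-! ### Fourier integrals in time: differentiation and exchange with spatial means. -/

/-- The function `(iω)^k w(ω)`, whose transform is the `k`-th time derivative. -/
noncomputable def freqMul (k : ℕ) (w : ℝ → ℂ) (ω : ℝ) : ℂ := (Complex.I * ω) ^ k * w ω

theorem freqMul_zero (w : ℝ → ℂ) : freqMul 0 w = w := by
  funext ω; simp [freqMul]

theorem freqMul_eq (k : ℕ) (w : ℝ → ℂ) :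
    freqMul k w = fun ω : ℝ => Complex.I ^ k * ((ω : ℂ) ^ k * w ω) := by
  funext ω; simp [freqMul, mul_pow, mul_assoc]

theorem norm_freqMul (k : ℕ) (w : ℝ → ℂ) (ω : ℝ) : ‖freqMul k w ω‖ = |ω| ^ k * ‖w ω‖ := by
  simp [freqMul]

theorem norm_exp_I_mul (a t : ℝ) : ‖Complex.exp (Complex.I * a * t)‖ = 1 := by
  have : Complex.I * a * t = ((a * t : ℝ) : ℂ) * Complex.I := by push_cast; ring
  rw [this, Complex.norm_exp_ofReal_mul_I]

theorem integrable_mul_exp {w : ℝ → ℂ} (hw : Integrable w) (t : ℝ) :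
    Integrable fun ω : ℝ => w ω * Complex.exp (Complex.I * ω * t) :=
  hw.mul_bdd (c := 1) (by fun_prop) (Eventually.of_forall fun ω => (norm_exp_I_mul ω t).le)

theorem norm_invFourier_le (w : ℝ → ℂ) (t : ℝ) : ‖invFourier w t‖ ≤ ∫ ω, ‖w ω‖ := by
  refine (norm_integral_le_integral_norm _).trans (le_of_eq ?_)
  simp [norm_exp_I_mul]

/-- Differentiation under the integral: the modulus of the differentiated integrand does not depend
on `t`, so it serves as its own dominating function. -/
theorem hasDerivAt_invFourier {w : ℝ → ℂ} {k : ℕ} (h0 : Integrable (freqMul k w))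
    (h1 : Integrable (freqMul (k + 1) w)) (t : ℝ) :
    HasDerivAt (invFourier (freqMul k w)) (invFourier (freqMul (k + 1) w) t) t := by
  refine (hasDerivAt_integral_of_dominated_loc_of_deriv_le (𝕜 := ℝ)
    (F := fun t ω => freqMul k w ω * Complex.exp (Complex.I * ω * t))
    (F' := fun t ω => freqMul (k + 1) w ω * Complex.exp (Complex.I * ω * t))
    (bound := fun ω => ‖freqMul (k + 1) w ω‖) (s := Set.univ) univ_mem
    (Eventually.of_forall fun τ => (integrable_mul_exp h0 τ).aestronglyMeasurable)
    (integrable_mul_exp h0 t) (integrable_mul_exp h1 t).aestronglyMeasurable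
    (Eventually.of_forall fun ω τ _ => by rw [norm_mul, norm_exp_I_mul, mul_one])
    h1.norm (Eventually.of_forall fun ω τ _ => ?_)).2
  have hlin : HasDerivAt (fun τ : ℝ => Complex.I * ω * (τ : ℂ)) (Complex.I * ω) τ := by
    simpa using (Complex.ofRealCLM.hasDerivAt (x := τ)).const_mul (Complex.I * (ω : ℂ))
  refine (hlin.cexp.const_mul (freqMul k w ω)).congr_deriv ?_
  simp only [freqMul]
  ring

theorem stronglyMeasurable_field {w : ℝ → ℝ → ℂ} (hw : Measurable (Function.uncurry w)) (t : ℝ) :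
    StronglyMeasurable fun x => field w x t := by
  have : Measurable (Function.uncurry fun x ω : ℝ => w x ω * Complex.exp (Complex.I * ω * t)) :=
    hw.mul (by fun_prop)
  exact this.stronglyMeasurable.integral_prod_right

section Fubini

variable {w : ℝ → ℝ → ℂ} {C a b : ℝ}

/-- Tonelli: the `L¹` norms of the slices are bounded uniformly in `x`, and the interval has finite
length. -/
theorem integrable_uncurry_restrict (hw : Measurable (Function.uncurry w))
    (hi : ∀ x, Integrable (w x)) (hC : ∀ x, ∫ ω, ‖w x ω‖ ≤ C) :
    Integrable (Function.uncurry w) ((volume.restrict (Set.Ioo a b)).prod volume) := by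
  rw [integrable_prod_iff hw.aestronglyMeasurable]
  refine ⟨Eventually.of_forall hi, ?_⟩
  refine Measure.integrableOn_of_bounded (M := C) (by simp)
    (hw.norm.stronglyMeasurable.integral_prod_right (f := fun x ω => ‖w x ω‖)).aestronglyMeasurable
    (Eventually.of_forall fun x => ?_)
  rw [Real.norm_of_nonneg (integral_nonneg fun ω => norm_nonneg _)]
  exact hC x

theorem integrable_integral_Ioo (hw : Measurable (Function.uncurry w))
    (hi : ∀ x, Integrable (w x)) (hC : ∀ x, ∫ ω, ‖w x ω‖ ≤ C) :
    Integrable fun ω => ∫ x in Set.Ioo a b, w x ω :=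
  (integrable_uncurry_restrict hw hi hC).integral_prod_right

theorem invFourier_integral_Ioo (hw : Measurable (Function.uncurry w))
    (hi : ∀ x, Integrable (w x)) (hC : ∀ x, ∫ ω, ‖w x ω‖ ≤ C) (t : ℝ) :
    invFourier (fun ω => ∫ x in Set.Ioo a b, w x ω) t = ∫ x in Set.Ioo a b, field w x t := by
  have h : Integrable (Function.uncurry fun x ω : ℝ => w x ω * Complex.exp (Complex.I * ω * t))
      ((volume.restrict (Set.Ioo a b)).prod volume) :=
    (integrable_uncurry_restrict hw hi hC).mul_bdd (c := 1) (by fun_prop)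
      (Eventually.of_forall fun z => (norm_exp_I_mul z.2 t).le)
  simp only [invFourier, field]
  rw [integral_integral_swap h]
  simp only [integral_mul_const]

end Fubini

/-! ### Periodicity of the array and numbering of its resonators. -/

namespace Chain

variable {N : ℕ}

theorem neZero (G : Chain N) : NeZero N := by
  refine ⟨?_⟩
  rintro rfl
  have h := G.xm_add 0
  have := G.L_pos
  simp at h
  linarith

theorem xm_add_mul (G : Chain N) (k m : ℤ) : G.xm (k + m * N) = G.xm k + m * G.L := by
  induction m using Int.induction_on with
  | zero => simp
  | succ n ih =>
    have := G.xm_add (k + n * N)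
    rw [show k + ((n : ℤ) + 1) * N = k + n * N + N by ring, this, ih]
    push_cast; ring
  | pred n ih =>
    have := G.xm_add (k + (-(n : ℤ) - 1) * N)
    rw [show k + (-(n : ℤ) - 1) * N + N = k + -(n : ℤ) * N by ring, ih] at this
    push_cast at this ⊢
    linarith

theorem xp_add_mul (G : Chain N) (k m : ℤ) : G.xp (k + m * N) = G.xp k + m * G.L := by
  induction m using Int.induction_on with
  | zero => simp
  | succ n ih =>
    have := G.xp_add (k + n * N)
    rw [show k + ((n : ℤ) + 1) * N = k + n * N + N by ring, this, ih]
    push_cast; ring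
  | pred n ih =>
    have := G.xp_add (k + (-(n : ℤ) - 1) * N)
    rw [show k + (-(n : ℤ) - 1) * N + N = k + -(n : ℤ) * N by ring, ih] at this
    push_cast at this ⊢
    linarith

theorem xm_strictMono (G : Chain N) : StrictMono G.xm :=
  strictMono_int_of_lt_succ fun k => (G.xm_lt_xp k).trans (G.xp_lt_xm k)

theorem xp_strictMono (G : Chain N) : StrictMono G.xp :=
  strictMono_int_of_lt_succ fun k => (G.xp_lt_xm k).trans (G.xm_lt_xp (k + 1))

/-- The width of the gap between the resonators number `k` and `k + 1`. -/
def gapLen (G : Chain N) (k : ℤ) : ℝ := G.xm (k + 1) - G.xp k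

theorem gapLen_pos (G : Chain N) (k : ℤ) : 0 < G.gapLen k := sub_pos.2 (G.xp_lt_xm k)

theorem gapLen_add_mul (G : Chain N) (k m : ℤ) : G.gapLen (k + m * N) = G.gapLen k := by
  unfold gapLen
  rw [show k + m * N + 1 = k + 1 + m * N by ring, xm_add_mul, xp_add_mul]
  ring

theorem xm_idx (G : Chain N) (m : ℤ) (i : Fin N) :
    G.xm (idx m i) = G.xm (idx 0 i) + m * G.L := by
  rw [← xm_add_mul]; congr 1; simp only [idx]; ring

theorem xp_idx (G : Chain N) (m : ℤ) (i : Fin N) :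
    G.xp (idx m i) = G.xp (idx 0 i) + m * G.L := by
  rw [← xp_add_mul]; congr 1; simp only [idx]; ring

theorem len_eq (G : Chain N) (m : ℤ) (i : Fin N) :
    G.len i = G.xp (idx m i) - G.xm (idx m i) := by
  rw [xm_idx, xp_idx, len]; ring

theorem len_pos (G : Chain N) (i : Fin N) : 0 < G.len i := sub_pos.2 (G.xm_lt_xp _)

theorem gapLen_le (G : Chain N) (k : ℤ) : G.gapLen k ≤ G.L := by
  have : NeZero N := G.neZero
  have hN : (1 : ℤ) ≤ N := by exact_mod_cast NeZero.one_le
  have h1 : G.xm (k + 1) ≤ G.xm (k + N) := G.xm_strictMono.monotone (by omega)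
  rw [G.xm_add] at h1
  have := G.xm_lt_xp k
  unfold gapLen
  linarith

theorem len_le (G : Chain N) (i : Fin N) : G.len i ≤ G.L := by
  have : NeZero N := G.neZero
  have hN : (1 : ℤ) ≤ N := by exact_mod_cast NeZero.one_le
  have h1 : G.xm (idx 0 i + 1) ≤ G.xm (idx 0 i + N) := G.xm_strictMono.monotone (by omega)
  rw [G.xm_add] at h1
  have := G.xp_lt_xm (idx 0 i)
  unfold len
  linarith

end Chain

section Index

variable {N : ℕ} [NeZero N]

/-- The position within its cell of the resonator number `k` of the array. -/
def resIdx (N : ℕ) [NeZero N] (k : ℤ) : Fin N :=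
  ⟨(k % N).toNat, by
    have hN : (0 : ℤ) < N := by exact_mod_cast NeZero.pos N
    have := Int.emod_lt_of_pos k hN
    have := Int.emod_nonneg k hN.ne'
    omega⟩

theorem idx_resIdx (k : ℤ) : idx (k / N) (resIdx N k) = k := by
  have hN : (N : ℤ) ≠ 0 := by exact_mod_cast NeZero.ne N
  have h : (((k % N).toNat : ℕ) : ℤ) = k % N := Int.toNat_of_nonneg (Int.emod_nonneg k hN)
  simp only [idx, resIdx, h]
  exact Int.ediv_mul_add_emod k N

theorem idx_ediv (m : ℤ) (i : Fin N) : idx m i / (N : ℤ) = m := by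
  have hN : (N : ℤ) ≠ 0 := by exact_mod_cast NeZero.ne N
  have hi : ((i : ℕ) : ℤ) < N := by exact_mod_cast i.2
  rw [idx, add_comm, Int.add_mul_ediv_right _ _ hN, Int.ediv_eq_zero_of_lt (by positivity) hi,
    zero_add]

theorem resIdx_idx (m : ℤ) (i : Fin N) : resIdx N (idx m i) = i := by
  have hi : ((i : ℕ) : ℤ) < N := by exact_mod_cast i.2
  ext
  simp only [idx, resIdx]
  rw [add_comm, Int.add_mul_emod_self_right, Int.emod_eq_of_lt (by positivity) hi]
  simp

theorem idx_eq_iff (m n : ℤ) (i j : Fin N) : idx m i = idx n j ↔ m = n ∧ i = j := by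
  refine ⟨fun h => ⟨?_, ?_⟩, fun h => by rw [h.1, h.2]⟩
  · rw [← idx_ediv m i, h, idx_ediv]
  · rw [← resIdx_idx m i, h, resIdx_idx]

end Index

namespace Chain

variable {N : ℕ}

/-- Gap widths are `N`-periodic, so a minimum over one cell bounds them all; the final constant
thereby depends on the geometry alone. -/
theorem exists_pos_le_gapLen (G : Chain N) : ∃ g : ℝ, 0 < g ∧ ∀ k, g ≤ G.gapLen k := by
  have : NeZero N := G.neZero
  obtain ⟨i, hi⟩ := Finite.exists_min fun i : Fin N => G.gapLen (idx 0 i)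
  refine ⟨_, G.gapLen_pos (idx 0 i), fun k => (hi (resIdx N k)).trans (le_of_eq ?_)⟩
  rw [← G.gapLen_add_mul _ (k / N)]
  conv_rhs => rw [← idx_resIdx (N := N) k]
  congr 1
  simp only [idx]; ring

theorem exists_pos_le_len (G : Chain N) : ∃ g : ℝ, 0 < g ∧ ∀ i, g ≤ G.len i := by
  have : NeZero N := G.neZero
  obtain ⟨i, hi⟩ := Finite.exists_min fun i : Fin N => G.len i
  exact ⟨_, G.len_pos i, hi⟩

/-! ### Piecewise linear interpolation along the array. -/

/-- The continuous piecewise linear function equal to `1` on the resonator number `k` and to `0`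
on the other resonators. -/
noncomputable def hat (G : Chain N) (k : ℤ) (x : ℝ) : ℝ :=
  -- The smaller of a ramp rising across the gap `k - 1` and a ramp falling across the gap `k`,
  -- clipped to `[0, 1]`.
  max 0 (min 1 (min ((x - G.xp (k - 1)) / G.gapLen (k - 1)) ((G.xm (k + 1) - x) / G.gapLen k)))

theorem continuous_hat (G : Chain N) (k : ℤ) : Continuous (G.hat k) := by
  unfold hat; fun_prop

theorem hat_of_le (G : Chain N) {k : ℤ} {x : ℝ} (hx : x ≤ G.xp (k - 1)) : G.hat k x = 0 := by
  have : (x - G.xp (k - 1)) / G.gapLen (k - 1) ≤ 0 :=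
    div_nonpos_of_nonpos_of_nonneg (by linarith) (G.gapLen_pos _).le
  exact max_eq_left ((min_le_right _ _).trans ((min_le_left _ _).trans this))

theorem hat_of_ge (G : Chain N) {k : ℤ} {x : ℝ} (hx : G.xm (k + 1) ≤ x) : G.hat k x = 0 := by
  have : (G.xm (k + 1) - x) / G.gapLen k ≤ 0 :=
    div_nonpos_of_nonpos_of_nonneg (by linarith) (G.gapLen_pos _).le
  exact max_eq_left ((min_le_right _ _).trans ((min_le_right _ _).trans this))

theorem hat_resonator (G : Chain N) {k : ℤ} {x : ℝ} (hx : x ∈ Set.Icc (G.xm k) (G.xp k)) :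
    G.hat k x = 1 := by
  have h1 : 1 ≤ (x - G.xp (k - 1)) / G.gapLen (k - 1) := by
    rw [le_div_iff₀ (G.gapLen_pos _), gapLen, sub_add_cancel]; linarith [hx.1]
  have h2 : 1 ≤ (G.xm (k + 1) - x) / G.gapLen k := by
    rw [le_div_iff₀ (G.gapLen_pos _), gapLen]; linarith [hx.2]
  rw [hat, min_eq_left (le_min h1 h2), max_eq_right zero_le_one]

theorem hat_gap_left (G : Chain N) {k : ℤ} {x : ℝ} (hx : x ∈ G.gap k) :
    G.hat k x = (G.xm (k + 1) - x) / G.gapLen k := by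
  have hx' : G.xp k < x ∧ x < G.xm (k + 1) := hx
  have h1 : 1 ≤ (x - G.xp (k - 1)) / G.gapLen (k - 1) := by
    rw [le_div_iff₀ (G.gapLen_pos _), gapLen, sub_add_cancel]; linarith [hx'.1, G.xm_lt_xp k]
  have h2 : (G.xm (k + 1) - x) / G.gapLen k ≤ 1 := by
    rw [div_le_iff₀ (G.gapLen_pos _), gapLen]; linarith [hx'.1]
  have h3 : 0 ≤ (G.xm (k + 1) - x) / G.gapLen k :=
    div_nonneg (by linarith [hx'.2]) (G.gapLen_pos _).le
  rw [hat, min_eq_right (h2.trans h1), min_eq_right h2, max_eq_right h3]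

theorem hat_gap_right (G : Chain N) {k : ℤ} {x : ℝ} (hx : x ∈ G.gap k) :
    G.hat (k + 1) x = (x - G.xp k) / G.gapLen k := by
  have hx' : G.xp k < x ∧ x < G.xm (k + 1) := hx
  have h1 : 1 ≤ (G.xm (k + 1 + 1) - x) / G.gapLen (k + 1) := by
    rw [le_div_iff₀ (G.gapLen_pos _), gapLen]; linarith [hx'.2, G.xm_lt_xp (k + 1)]
  have h2 : (x - G.xp k) / G.gapLen k ≤ 1 := by
    rw [div_le_iff₀ (G.gapLen_pos _), gapLen]; linarith [hx'.2]
  have h3 : 0 ≤ (x - G.xp k) / G.gapLen k :=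
    div_nonneg (by linarith [hx'.1]) (G.gapLen_pos _).le
  rw [hat, add_sub_cancel_right, min_eq_left (h2.trans h1), min_eq_right h2, max_eq_right h3]

theorem hat_add_mul (G : Chain N) (k m : ℤ) (x : ℝ) :
    G.hat (k + m * N) (x + m * G.L) = G.hat k x := by
  unfold hat
  rw [show k + m * N - 1 = k - 1 + m * N by ring, show k + m * N + 1 = k + 1 + m * N by ring,
    xm_add_mul, xp_add_mul, gapLen_add_mul, gapLen_add_mul, add_sub_add_right_eq_sub,
    add_sub_add_right_eq_sub]

theorem hat_ne_zero (G : Chain N) {k : ℤ} {x : ℝ} (hx : G.hat k x ≠ 0) :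
    G.xp (k - 1) < x ∧ x < G.xm (k + 1) :=
  ⟨not_le.1 fun h => hx (G.hat_of_le h), not_le.1 fun h => hx (G.hat_of_ge h)⟩

/-- The continuous piecewise linear function with the value `a k` on the resonator number `k`. -/
noncomputable def interp (G : Chain N) (a : ℤ → ℂ) (x : ℝ) : ℂ := ∑ᶠ k, a k * (G.hat k x : ℂ)

theorem continuous_interp (G : Chain N) (a : ℤ → ℂ) : Continuous (G.interp a) := by
  refine continuous_finsum
    (fun k => continuous_const.mul (Complex.continuous_ofReal.comp (G.continuous_hat k)))
    fun x => ⟨Set.Ioo (x - 1) (x + 1), Ioo_mem_nhds (by linarith) (by linarith), ?_⟩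
  -- Local finiteness: `p` periods to the right and `q` to the left of the central cell lead out of
  -- the window `(x - 1, x + 1)`, so only hats with index between about `-q N` and `p N` meet it.
  obtain ⟨p, hp⟩ := exists_nat_gt ((x + 1 - G.xp 0) / G.L)
  obtain ⟨q, hq⟩ := exists_nat_gt ((G.xm 0 - (x - 1)) / G.L)
  rw [div_lt_iff₀ G.L_pos] at hp hq
  have hp' := G.xp_add_mul 0 p
  have hq' := G.xm_add_mul 0 (-q)
  push_cast at hp' hq'
  refine (Set.finite_Icc (-(q : ℤ) * N - 1) (p * N + 1)).subset ?_
  rintro k ⟨y, hy, hy1, hy2⟩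
  have hne : G.hat k y ≠ 0 := fun h => hy (by simp [h])
  obtain ⟨h1, h2⟩ := G.hat_ne_zero hne
  have h3 : k - 1 < 0 + p * N := G.xp_strictMono.lt_iff_lt.1 (by linarith)
  have h4 : 0 + -(q : ℤ) * N < k + 1 := G.xm_strictMono.lt_iff_lt.1 (by linarith)
  exact ⟨by linarith, by linarith⟩

theorem interp_resonator (G : Chain N) (a : ℤ → ℂ) {k : ℤ} {x : ℝ}
    (hx : x ∈ Set.Icc (G.xm k) (G.xp k)) : G.interp a x = a k := by
  rw [interp, finsum_eq_single _ k, G.hat_resonator hx]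
  · simp
  · intro l hl
    have : G.hat l x = 0 := by
      rcases hl.lt_or_gt with h | h
      · exact G.hat_of_ge ((G.xm_strictMono.monotone (by omega : l + 1 ≤ k)).trans hx.1)
      · exact G.hat_of_le (hx.2.trans (G.xp_strictMono.monotone (by omega : k ≤ l - 1)))
    simp [this]

theorem interp_gap (G : Chain N) (a : ℤ → ℂ) {k : ℤ} {x : ℝ} (hx : x ∈ G.gap k) :
    G.interp a x = a k * (((G.xm (k + 1) - x) / G.gapLen k : ℝ) : ℂ)
      + a (k + 1) * (((x - G.xp k) / G.gapLen k : ℝ) : ℂ) := by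
  have hx' : G.xp k < x ∧ x < G.xm (k + 1) := hx
  rw [interp, finsum_eq_sum_of_support_subset (s := {k, k + 1}), Finset.sum_pair (by omega),
    G.hat_gap_left hx, G.hat_gap_right hx]
  intro l hl
  have hne : G.hat l x ≠ 0 := fun h => hl (by simp [h])
  obtain ⟨h1, h2⟩ := G.hat_ne_zero hne
  have h3 : l - 1 < k + 1 := G.xp_strictMono.lt_iff_lt.1
    (by linarith [G.xm_lt_xp (k + 1)])
  have h4 : k < l + 1 := G.xm_strictMono.lt_iff_lt.1 (by linarith [G.xm_lt_xp k])
  have : l = k ∨ l = k + 1 := by omega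
  simpa using this

/-- A shift by `m` cells permutes the hat functions, so the sum is reindexed by `k ↦ k + m N`. -/
theorem interp_add_mul (G : Chain N) (a : ℤ → ℂ) {c : ℂ} {m : ℤ}
    (ha : ∀ k, a (k + m * N) = c * a k) (x : ℝ) : G.interp a (x + m * G.L) = c * G.interp a x := by
  unfold interp
  rw [mul_finsum, ← finsum_comp_equiv (Equiv.addRight (m * (N : ℤ)))]
  refine finsum_congr fun k => ?_
  rw [Equiv.coe_addRight, G.hat_add_mul, ha, mul_assoc]

end Chain
-- The potentials `V_j^α` and their slopes.
namespace Chain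

variable {N : ℕ}

/-- The value of `V_j^α` on the resonator number `k` of the array. -/
noncomputable def blochValue [NeZero N] (G : Chain N) (α : ℝ) (j : Fin N) (k : ℤ) : ℂ :=
  Complex.exp (Complex.I * α * (k / N : ℤ) * G.L) * if resIdx N k = j then 1 else 0

theorem blochValue_idx [NeZero N] (G : Chain N) (α : ℝ) (j : Fin N) (m : ℤ) (i : Fin N) :
    G.blochValue α j (idx m i)
      = Complex.exp (Complex.I * α * m * G.L) * if i = j then 1 else 0 := by
  rw [blochValue, idx_ediv, resIdx_idx]

theorem blochValue_add_mul [NeZero N] (G : Chain N) (α : ℝ) (j : Fin N) (k m : ℤ) :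
    G.blochValue α j (k + m * N)
      = Complex.exp (Complex.I * α * m * G.L) * G.blochValue α j k := by
  rw [← idx_resIdx (N := N) k,
    show idx (k / N) (resIdx N k) + m * N = idx (k / N + m) (resIdx N k) by simp only [idx]; ring,
    blochValue_idx, blochValue_idx, ← mul_assoc, ← Complex.exp_add]
  push_cast
  ring_nf

/-- Existence is what gives content to `potential`, which is chosen by `Classical.epsilon`.
Uniqueness need not be proved: the slopes are computed below for any solution. -/
theorem isPotential_interp [NeZero N] (G : Chain N) (α : ℝ) (j : Fin N) :
    G.IsPotential α j (G.interp (G.blochValue α j)) := by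
  set a := G.blochValue α j with ha
  have hgap : ∀ k, Set.EqOn (G.interp a) (fun x : ℝ =>
      a k * (((G.xm (k + 1) - x) / G.gapLen k : ℝ) : ℂ)
        + a (k + 1) * (((x - G.xp k) / G.gapLen k : ℝ) : ℂ)) (G.gap k) :=
    fun k x hx => G.interp_gap a hx
  refine ⟨G.continuous_interp a, fun k => ?_, fun k x hx => ?_, fun i x hx => ?_, fun x m => ?_⟩
  · refine ContDiffOn.congr (ContDiff.contDiffOn ?_) (hgap k)
    have h1 : ContDiff ℝ 2 fun x : ℝ => (G.xm (k + 1) - x) / G.gapLen k := by fun_prop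
    have h2 : ContDiff ℝ 2 fun x : ℝ => (x - G.xp k) / G.gapLen k := by fun_prop
    exact (contDiff_const.mul (Complex.ofRealCLM.contDiff.comp h1)).add
      (contDiff_const.mul (Complex.ofRealCLM.contDiff.comp h2))
  · have hd : ∀ y ∈ G.gap k, deriv (G.interp a) y
        = a k * ((-1 / G.gapLen k : ℝ) : ℂ) + a (k + 1) * ((1 / G.gapLen k : ℝ) : ℂ) := by
      intro y hy
      rw [((hgap k).eventuallyEq_of_mem (isOpen_Ioo.mem_nhds hy)).deriv_eq]
      have h1 : HasDerivAt (fun x : ℝ => (((G.xm (k + 1) - x) / G.gapLen k : ℝ) : ℂ))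
          ((-1 / G.gapLen k : ℝ) : ℂ) y :=
        (((hasDerivAt_id y).const_sub _).div_const _).ofReal_comp
      have h2 : HasDerivAt (fun x : ℝ => (((x - G.xp k) / G.gapLen k : ℝ) : ℂ))
          ((1 / G.gapLen k : ℝ) : ℂ) y :=
        (((hasDerivAt_id y).sub_const _).div_const _).ofReal_comp
      exact ((h1.const_mul _).add (h2.const_mul _)).deriv
    have : deriv (G.interp a) =ᶠ[𝓝 x] fun _ =>
        a k * ((-1 / G.gapLen k : ℝ) : ℂ) + a (k + 1) * ((1 / G.gapLen k : ℝ) : ℂ) :=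
      Filter.eventuallyEq_of_mem (isOpen_Ioo.mem_nhds hx) hd
    rw [this.deriv_eq, deriv_const]
  · rw [G.interp_resonator a (Set.Ioo_subset_Icc_self hx), ha, blochValue_idx]
    simp
  · exact G.interp_add_mul a (fun k => G.blochValue_add_mul α j k m) x

theorem isPotential_potential [NeZero N] (G : Chain N) (α : ℝ) (j : Fin N) :
    G.IsPotential α j (G.potential α j) :=
  Classical.epsilon_spec (p := G.IsPotential α j) ⟨_, G.isPotential_interp α j⟩

namespace IsPotential

variable [NeZero N] {G : Chain N} {α : ℝ} {j : Fin N} {V : ℝ → ℂ}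

theorem eq_on_resonator (hV : G.IsPotential α j V) {k : ℤ} {x : ℝ}
    (hx : x ∈ Set.Ioo (G.xm k) (G.xp k)) : V x = G.blochValue α j k := by
  obtain ⟨m, i, rfl⟩ : ∃ m i, idx (N := N) m i = k := ⟨_, _, idx_resIdx k⟩
  have h := hV.quasiperiodic (x - m * G.L) m
  rw [sub_add_cancel] at h
  rw [h, blochValue_idx, hV.on_resonator i]
  rw [G.xm_idx, G.xp_idx] at hx
  exact ⟨by linarith [hx.1], by linarith [hx.2]⟩

theorem eq_at_xm (hV : G.IsPotential α j V) (k : ℤ) : V (G.xm k) = G.blochValue α j k := by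
  have h1 : Tendsto V (𝓝[>] (G.xm k)) (𝓝 (V (G.xm k))) :=
    (hV.continuous.tendsto _).mono_left nhdsWithin_le_nhds
  refine tendsto_nhds_unique h1 (tendsto_const_nhds.congr' ?_)
  filter_upwards [Ioo_mem_nhdsGT (G.xm_lt_xp k)] with x hx using (hV.eq_on_resonator hx).symm

theorem eq_at_xp (hV : G.IsPotential α j V) (k : ℤ) : V (G.xp k) = G.blochValue α j k := by
  have h1 : Tendsto V (𝓝[<] (G.xp k)) (𝓝 (V (G.xp k))) :=
    (hV.continuous.tendsto _).mono_left nhdsWithin_le_nhds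
  refine tendsto_nhds_unique h1 (tendsto_const_nhds.congr' ?_)
  filter_upwards [Ioo_mem_nhdsLT (G.xm_lt_xp k)] with x hx using (hV.eq_on_resonator hx).symm

/-- A harmonic function on a gap is affine: this is `norm_end_slopes_sub_le` with `C = 0`, the end
values being known by continuity from the adjacent resonators. -/
theorem slopes (hV : G.IsPotential α j V) (k : ℤ) :
    Function.rightLim (deriv V) (G.xp k)
        = (G.blochValue α j (k + 1) - G.blochValue α j k) / (G.gapLen k : ℂ) ∧
      Function.leftLim (deriv V) (G.xm (k + 1))
        = (G.blochValue α j (k + 1) - G.blochValue α j k) / (G.gapLen k : ℂ) := by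
  have hlt := G.xp_lt_xm k
  obtain ⟨z, hz⟩ := Set.nonempty_Ioo.2 hlt
  have hC : ∀ x ∈ Set.Ioo (G.xp k) (G.xm (k + 1)), ‖deriv (deriv V) x‖ ≤ 0 := fun x hx => by
    rw [hV.harmonic k x hx, norm_zero]
  have hconst : ∀ x ∈ Set.Ioo (G.xp k) (G.xm (k + 1)), deriv V z = deriv V x := fun x hx => by
    have := norm_sub_le_of_norm_deriv_le_Ioo
      (fun x hx => differentiableAt_deriv_of_contDiffOn_Ioo (hV.smooth k) hx) hC hx hz
    rw [zero_mul] at this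
    exact sub_eq_zero.1 (norm_le_zero_iff.1 this)
  have hp : Tendsto (deriv V) (𝓝[>] (G.xp k)) (𝓝 (deriv V z)) :=
    tendsto_const_nhds.congr' (Filter.eventuallyEq_of_mem (Ioo_mem_nhdsGT hlt) hconst)
  have hq : Tendsto (deriv V) (𝓝[<] (G.xm (k + 1))) (𝓝 (deriv V z)) :=
    tendsto_const_nhds.congr' (Filter.eventuallyEq_of_mem (Ioo_mem_nhdsLT hlt) hconst)
  have h := (norm_end_slopes_sub_le hlt (hV.smooth k) hC
    ((hV.continuous.tendsto _).mono_left nhdsWithin_le_nhds)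
    ((hV.continuous.tendsto _).mono_left nhdsWithin_le_nhds) hp hq).1
  rw [zero_mul, norm_le_zero_iff, sub_eq_zero, hV.eq_at_xm, hV.eq_at_xp] at h
  rw [rightLim_eq_of_tendsto hp, leftLim_eq_of_tendsto hq]
  exact ⟨h, h⟩

end IsPotential

/-! ### The capacitance matrix as a difference operator, in Bloch and in real space. -/

/-- The nearest-neighbour difference operator of the array, at the resonator number `k`: the flux of
the piecewise linear interpolation out of this resonator. -/
noncomputable def laplace (G : Chain N) (k : ℤ) : (ℤ → ℂ) →ₗ[ℂ] ℂ where
  toFun a := (a k - a (k - 1)) / (G.gapLen (k - 1) : ℂ) - (a (k + 1) - a k) / (G.gapLen k : ℂ)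
  map_add' a b := by simp only [Pi.add_apply]; ring
  map_smul' c a := by simp only [Pi.smul_apply, smul_eq_mul, RingHom.id_apply]; ring

theorem laplace_apply (G : Chain N) (k : ℤ) (a : ℤ → ℂ) : G.laplace k a =
    (a k - a (k - 1)) / (G.gapLen (k - 1) : ℂ) - (a (k + 1) - a k) / (G.gapLen k : ℂ) := rfl

theorem laplace_add_mul (G : Chain N) (k m : ℤ) (a : ℤ → ℂ) :
    G.laplace (k + m * N) a = G.laplace k fun l => a (l + m * N) := by
  simp only [laplace_apply]
  rw [show k + m * N - 1 = k - 1 + m * N by ring, show k + m * N + 1 = k + 1 + m * N by ring,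
    gapLen_add_mul, gapLen_add_mul]

theorem hasSum_laplace (G : Chain N) (k : ℤ) {F : ℤ → ℤ → ℂ} {W : ℤ → ℂ}
    (h : ∀ l, HasSum (fun n => F n l) (W l)) :
    HasSum (fun n => G.laplace k (F n)) (G.laplace k W) := by
  simp only [laplace_apply]
  exact (((h _).sub (h _)).div_const _).sub (((h _).sub (h _)).div_const _)

theorem capMatrix_apply [NeZero N] (G : Chain N) (α : ℝ) (i j : Fin N) :
    G.capMatrix α i j = G.laplace (idx 0 i) (G.blochValue α j) := by
  -- The left end of a resonator borders the gap numbered one less.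
  have h1 := ((G.isPotential_potential α j).slopes (idx 0 i - 1)).2
  rw [sub_add_cancel] at h1
  rw [capMatrix, Matrix.of_apply, bdryFlux, h1, ((G.isPotential_potential α j).slopes _).1,
    laplace_apply]

theorem integral_exp_bloch (G : Chain N) (q n : ℤ) :
    ∫ α in (-(Real.pi / G.L))..(Real.pi / G.L),
      Complex.exp (Complex.I * α * q * G.L) * Complex.exp (-(Complex.I * α * n * G.L))
      = if q = n then ((2 * Real.pi / G.L : ℝ) : ℂ) else 0 := by
  have hL : (G.L : ℂ) ≠ 0 := by exact_mod_cast G.L_pos.ne'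
  have e : ∀ α : ℝ,
      Complex.exp (Complex.I * α * q * G.L) * Complex.exp (-(Complex.I * α * n * G.L))
        = Complex.exp (Complex.I * (q - n) * G.L * α) := fun α => by
    rw [← Complex.exp_add]; ring_nf
  simp only [e]
  split_ifs with h
  · subst h
    simp only [sub_self, mul_zero, zero_mul, Complex.exp_zero, intervalIntegral.integral_const,
      Complex.real_smul, mul_one]
    push_cast; ring
  · have hqn : (q : ℂ) - n ≠ 0 := sub_ne_zero.2 (by exact_mod_cast h)
    rw [integral_exp_mul_complex (mul_ne_zero (mul_ne_zero Complex.I_ne_zero hqn) hL),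
      div_eq_zero_iff]
    left
    rw [sub_eq_zero, Complex.exp_eq_exp_iff_exists_int]
    -- The exponents at `α = ±π/L` are `±iπ(q - n)`; they differ by `q - n` periods `2πi`.
    refine ⟨q - n, ?_⟩
    push_cast
    field_simp
    ring

/-- Orthogonality of characters: over one Brillouin zone the phase `e^{iαqL}` is seen only by the
lattice point `n = q`. -/
theorem invBloch_blochValue [NeZero N] (G : Chain N) (j : Fin N) (k n : ℤ) :
    ((G.L / (2 * Real.pi) : ℝ) : ℂ) * ∫ α in (-(Real.pi / G.L))..(Real.pi / G.L),
      G.blochValue α j k * Complex.exp (-(Complex.I * α * n * G.L))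
      = if k = idx n j then 1 else 0 := by
  obtain ⟨q, i, rfl⟩ : ∃ m i, idx (N := N) m i = k := ⟨_, _, idx_resIdx k⟩
  simp only [blochValue_idx, mul_right_comm _ (ite _ _ _) _, intervalIntegral.integral_mul_const,
    integral_exp_bloch, idx_eq_iff]
  have hL : (G.L : ℂ) ≠ 0 := by exact_mod_cast G.L_pos.ne'
  have hpi : (Real.pi : ℂ) ≠ 0 := by exact_mod_cast Real.pi_ne_zero
  by_cases h1 : q = n <;> by_cases h2 : i = j <;> simp [h1, h2]
  field_simp

end Chain

namespace Material

variable {N : ℕ}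

theorem δ_pos (P : Material N) : 0 < P.δ := div_pos P.ρr_pos P.ρ0_pos

theorem vr_sq (P : Material N) : P.vr ^ 2 = P.κr / P.ρr :=
  Real.sq_sqrt (div_pos P.κr_pos P.ρr_pos).le

/-- The coefficients of `laplace` do not depend on `α`, so it commutes with the inverse Bloch
transform. Consequently an entry vanishes unless the two resonators coincide or are adjacent. -/
theorem realCap_apply [NeZero N] (P : Material N) (G : Chain N) (n : ℤ) (i j : Fin N) :
    P.realCap G n i j = ((P.δ * P.vr ^ 2 / G.len i : ℝ) : ℂ) *
      G.laplace (idx 0 i) fun l => if l = idx n j then 1 else 0 := by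
  have hint : ∀ k : ℤ, IntervalIntegrable (fun α : ℝ => G.blochValue α j k *
      Complex.exp (-(Complex.I * α * n * G.L))) volume (-(Real.pi / G.L)) (Real.pi / G.L) :=
    fun k => Continuous.intervalIntegrable (by unfold Chain.blochValue; fun_prop) _ _
  have e : ∀ α : ℝ, P.genCap G α i j * Complex.exp (-(Complex.I * α * n * G.L))
      = ((P.δ * P.vr ^ 2 / G.len i : ℝ) : ℂ) * G.laplace (idx 0 i) fun l =>
        G.blochValue α j l * Complex.exp (-(Complex.I * α * n * G.L)) := by
    intro α
    rw [genCap, Matrix.smul_apply, Matrix.diagonal_mul, G.capMatrix_apply, vr_sq,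
      Chain.laplace_apply, Chain.laplace_apply, smul_eq_mul]
    push_cast
    ring
  rw [realCap, Chain.invBloch, Matrix.of_apply]
  simp only [e, ← G.invBloch_blochValue, Chain.laplace_apply]
  rw [intervalIntegral.integral_const_mul, intervalIntegral.integral_sub,
    intervalIntegral.integral_div, intervalIntegral.integral_div,
    intervalIntegral.integral_sub (hint _) (hint _),
    intervalIntegral.integral_sub (hint _) (hint _)]
  · ring
  · exact ((hint _).sub (hint _)).div_const _
  · exact ((hint _).sub (hint _)).div_const _

/-- No decay of `w` is needed: only finitely many terms of the convolution are nonzero. -/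
theorem hasSum_realCap [NeZero N] (P : Material N) (G : Chain N) (m : ℤ) (w : ℤ → Fin N → ℂ) :
    HasSum (fun n : ℤ => Matrix.mulVec (P.realCap G (n - m)) (w n)) fun i =>
      ((P.δ * P.vr ^ 2 / G.len i : ℝ) : ℂ) *
        G.laplace (idx m i) fun l => w (l / N) (resIdx N l) := by
  rw [Pi.hasSum]
  intro i
  have e : ∀ n : ℤ, Matrix.mulVec (P.realCap G (n - m)) (w n) i
      = ((P.δ * P.vr ^ 2 / G.len i : ℝ) : ℂ) *
        G.laplace (idx 0 i) (∑ j, w n j • fun l => if l = idx (n - m) j then 1 else 0) := by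
    intro n
    rw [Matrix.mulVec, dotProduct, map_sum, Finset.mul_sum]
    refine Finset.sum_congr rfl fun j _ => ?_
    rw [realCap_apply, map_smul, smul_eq_mul]
    ring
  simp only [e]
  refine HasSum.mul_left _ ?_
  rw [show idx m i = idx 0 i + m * N by simp only [idx]; ring, G.laplace_add_mul]
  refine G.hasSum_laplace _ fun l => ?_
  -- Resonator `l`, counted from cell `m`, lies in exactly one cell `q`, so its series in `n` has
  -- one nonzero term.
  obtain ⟨q, r, hqr⟩ : ∃ q r, idx (N := N) q r = l + m * N := ⟨_, _, idx_resIdx _⟩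
  rw [← hqr, idx_ediv, resIdx_idx]
  have e2 : ∀ (n : ℤ) (j : Fin N), l = idx (n - m) j ↔ q = n ∧ r = j := fun n j => by
    rw [← idx_eq_iff, hqr, show idx (n - m) j = idx n j - m * N by simp only [idx]; ring]
    constructor <;> intro h <;> linarith
  simp only [Finset.sum_apply, Pi.smul_apply, smul_eq_mul, e2]
  have e3 : w q r = ∑ j, w q j * if q = q ∧ r = j then 1 else 0 := by simp
  rw [e3]
  refine hasSum_single q fun n hn => ?_
  simp [hn.symm]

end Material
-- Spatial estimates for the field at a fixed time.
variable {N : ℕ}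

/-- A wave profile at a fixed time: `h` is `C²` in each gap and each resonator, with inner traces
`a, b` and outer traces `σ a, σ b`, outer slopes `p, q` and inner slopes `τ p, τ q` at the left and
right ends of the resonators. -/
structure Profile (G : Chain N) (h : ℝ → ℂ) (σ τ a b p q : ℤ → ℂ) : Prop where
  smooth_gap : ∀ k, ContDiffOn ℝ 2 h (G.gap k)
  smooth_res : ∀ k, ContDiffOn ℝ 2 h (Set.Ioo (G.xm k) (G.xp k))
  left_out : ∀ k, Tendsto h (𝓝[<] (G.xm k)) (𝓝 (σ k * a k))
  left_in : ∀ k, Tendsto h (𝓝[>] (G.xm k)) (𝓝 (a k))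
  right_out : ∀ k, Tendsto h (𝓝[>] (G.xp k)) (𝓝 (σ k * b k))
  right_in : ∀ k, Tendsto h (𝓝[<] (G.xp k)) (𝓝 (b k))
  left_slope_out : ∀ k, Tendsto (deriv h) (𝓝[<] (G.xm k)) (𝓝 (p k))
  left_slope_in : ∀ k, Tendsto (deriv h) (𝓝[>] (G.xm k)) (𝓝 (τ k * p k))
  right_slope_out : ∀ k, Tendsto (deriv h) (𝓝[>] (G.xp k)) (𝓝 (q k))
  right_slope_in : ∀ k, Tendsto (deriv h) (𝓝[<] (G.xp k)) (𝓝 (τ k * q k))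

namespace Profile

variable {G : Chain N} {h : ℝ → ℂ} {σ τ a b p q : ℤ → ℂ} {A S T R Cg Cr g : ℝ}

theorem slopes_sub_le (H : Profile G h σ τ a b p q) (hCg0 : 0 ≤ Cg)
    (hCg : ∀ k, ∀ x ∈ G.gap k, ‖deriv (deriv h) x‖ ≤ Cg) (k : ℤ) :
    ‖q k - (σ (k + 1) * a (k + 1) - σ k * b k) / (G.gapLen k : ℂ)‖ ≤ Cg * G.L ∧
      ‖p (k + 1) - (σ (k + 1) * a (k + 1) - σ k * b k) / (G.gapLen k : ℂ)‖ ≤ Cg * G.L := by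
  have h1 := norm_end_slopes_sub_le (G.xp_lt_xm k) (H.smooth_gap k) (hCg k) (H.right_out k)
    (H.left_out (k + 1)) (H.right_slope_out k) (H.left_slope_out (k + 1))
  have h2 : Cg * (G.xm (k + 1) - G.xp k) ≤ Cg * G.L :=
    mul_le_mul_of_nonneg_left (G.gapLen_le k) hCg0
  exact ⟨h1.1.trans h2, h1.2.trans h2⟩

theorem norm_trace_sub_le (H : Profile G h σ τ a b p q) {k : ℤ} {c : ℂ}
    (hc : ∀ x ∈ Set.Ioo (G.xm k) (G.xp k), ‖h x - c‖ ≤ R) : ‖a k - c‖ ≤ R ∧ ‖b k - c‖ ≤ R := by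
  constructor
  · refine le_of_tendsto ((H.left_in k).sub tendsto_const_nhds).norm ?_
    filter_upwards [Ioo_mem_nhdsGT (G.xm_lt_xp k)] with x hx using hc x hx
  · refine le_of_tendsto ((H.right_in k).sub tendsto_const_nhds).norm ?_
    filter_upwards [Ioo_mem_nhdsLT (G.xm_lt_xp k)] with x hx using hc x hx

theorem norm_quotient_le {u v w : ℂ} {C : ℝ} {k : ℤ} (hg : 0 < g) (hgap : g ≤ G.gapLen k)
    (hu : ‖u‖ ≤ C) (hv : ‖v‖ ≤ C) (hw : w = (u - v) / (G.gapLen k : ℂ)) : ‖w‖ ≤ 2 * C / g := by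
  rw [hw, norm_div, Complex.norm_real, Real.norm_of_nonneg (hg.le.trans hgap)]
  have : ‖u - v‖ ≤ 2 * C := (norm_sub_le _ _).trans (by linarith)
  exact div_le_div₀ ((norm_nonneg _).trans this) this hg hgap

/-- Two outer traces of size at most `S A`, divided by a gap of width at least `g`, plus the
deviation from affinity. -/
theorem norm_slope_le (H : Profile G h σ τ a b p q) (hg : 0 < g) (hgap : ∀ k, g ≤ G.gapLen k)
    (hCg0 : 0 ≤ Cg) (hCg : ∀ k, ∀ x ∈ G.gap k, ‖deriv (deriv h) x‖ ≤ Cg)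
    (hA : ∀ x, ‖h x‖ ≤ A) (hS : ∀ k, ‖σ k‖ ≤ S) (k : ℤ) : ‖p k‖ ≤ 2 * (S * A) / g + Cg * G.L := by
  have hS0 : 0 ≤ S := (norm_nonneg _).trans (hS 0)
  have tr : ∀ k, ‖a k‖ ≤ A ∧ ‖b k‖ ≤ A := fun k => by
    simpa using H.norm_trace_sub_le (k := k) (c := 0) fun x _ => by simpa using hA x
  have h1 := (H.slopes_sub_le hCg0 hCg (k - 1)).2
  rw [sub_add_cancel] at h1
  have h2 := norm_quotient_le (C := S * A) hg (hgap (k - 1))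
    (by rw [norm_mul]; exact mul_le_mul (hS k) (tr k).1 (norm_nonneg _) hS0)
    (by rw [norm_mul]; exact mul_le_mul (hS (k - 1)) (tr (k - 1)).2 (norm_nonneg _) hS0) rfl
  have h3 := norm_add_le (p k - (σ k * a k - σ (k - 1) * b (k - 1)) / (G.gapLen (k - 1) : ℂ))
    ((σ k * a k - σ (k - 1) * b (k - 1)) / (G.gapLen (k - 1) : ℂ))
  rw [sub_add_cancel] at h3
  linarith

/-- The oscillation of a profile over a resonator. -/
theorem norm_sub_le_of_mem (H : Profile G h σ τ a b p q) (hg : 0 < g)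
    (hgap : ∀ k, g ≤ G.gapLen k) (hCg0 : 0 ≤ Cg) (hCr0 : 0 ≤ Cr)
    (hCg : ∀ k, ∀ x ∈ G.gap k, ‖deriv (deriv h) x‖ ≤ Cg) {k : ℤ}
    (hlen : G.xp k - G.xm k ≤ G.L)
    (hCr : ∀ x ∈ Set.Ioo (G.xm k) (G.xp k), ‖deriv (deriv h) x‖ ≤ Cr)
    (hA : ∀ x, ‖h x‖ ≤ A) (hS : ∀ k, ‖σ k‖ ≤ S) (hT : ‖τ k‖ ≤ T) {x y : ℝ}
    (hx : x ∈ Set.Ioo (G.xm k) (G.xp k)) (hy : y ∈ Set.Ioo (G.xm k) (G.xp k)) :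
    ‖h y - h x‖ ≤ (T * (2 * (S * A) / g + Cg * G.L) + Cr * G.L) * G.L := by
  have hlt := G.xm_lt_xp k
  have hT0 : 0 ≤ T := (norm_nonneg _).trans hT
  have hp := H.norm_slope_le hg hgap hCg0 hCg hA hS k
  have hp0 : 0 ≤ 2 * (S * A) / g + Cg * G.L := (norm_nonneg _).trans hp
  have key : ∀ x ∈ Set.Ioo (G.xm k) (G.xp k), ∀ y ∈ Set.Ioo (G.xm k) (G.xp k),
      ‖deriv h y - deriv h x‖ ≤ Cr * G.L := fun x hx y hy =>
    (norm_sub_le_of_norm_deriv_le_Ioo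
      (fun x hx => differentiableAt_deriv_of_contDiffOn_Ioo (H.smooth_res k) hx) hCr hx hy).trans
      (mul_le_mul_of_nonneg_left hlen hCr0)
  -- The inner slope starts at `τ k * p k`, small through `τ`, and changes by at most `Cr * L`
  -- across the resonator.
  have hder : ∀ z ∈ Set.Ioo (G.xm k) (G.xp k),
      ‖deriv h z‖ ≤ T * (2 * (S * A) / g + Cg * G.L) + Cr * G.L := by
    intro z hz
    have h1 := norm_sub_left_le hlt key (H.left_slope_in k) hz
    have h2 : ‖τ k * p k‖ ≤ T * (2 * (S * A) / g + Cg * G.L) := by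
      rw [norm_mul]; exact mul_le_mul hT hp (norm_nonneg _) hT0
    have h3 := norm_add_le (deriv h z - τ k * p k) (τ k * p k)
    rw [sub_add_cancel] at h3
    linarith
  refine (norm_sub_le_of_norm_deriv_le_Ioo
    (fun x hx => differentiableAt_of_contDiffOn_Ioo (H.smooth_res k) hx) hder hx hy).trans ?_
  exact mul_le_mul_of_nonneg_left hlen
    (add_nonneg (mul_nonneg hT0 hp0) (mul_nonneg hCr0 G.L_pos.le))

/-- The difference of the outer slopes at the ends of a resonator is approximated by the discrete
Laplacian of any sequence close to the profile on the resonators. -/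
theorem norm_laplace_add_le (H : Profile G h σ τ a b p q) (hg : 0 < g)
    (hgap : ∀ k, g ≤ G.gapLen k) (hCg0 : 0 ≤ Cg)
    (hCg : ∀ k, ∀ x ∈ G.gap k, ‖deriv (deriv h) x‖ ≤ Cg) (hS : ∀ k, ‖σ k‖ ≤ S) {U : ℤ → ℂ}
    (hU : ∀ k, ∀ x ∈ Set.Ioo (G.xm k) (G.xp k), ‖h x - U k‖ ≤ R) (k : ℤ) :
    ‖G.laplace k (fun l => σ l * U l) + (q k - p k)‖
      ≤ 2 * (Cg * G.L + 2 * (S * R) / g) := by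
  have hS0 : 0 ≤ S := (norm_nonneg _).trans (hS 0)
  have tr := fun k => H.norm_trace_sub_le (hU k)
  -- Cost of replacing both traces by `U`: each is within `R`, is multiplied by `σ`, and the gap is
  -- at least `g` wide.
  have quot : ∀ k, ‖(σ (k + 1) * a (k + 1) - σ k * b k) / (G.gapLen k : ℂ)
      - (σ (k + 1) * U (k + 1) - σ k * U k) / (G.gapLen k : ℂ)‖ ≤ 2 * (S * R) / g := fun k =>
    norm_quotient_le (u := σ (k + 1) * (a (k + 1) - U (k + 1))) (v := σ k * (b k - U k))
      hg (hgap k)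
      (by rw [norm_mul]; exact mul_le_mul (hS _) (tr _).1 (norm_nonneg _) hS0)
      (by rw [norm_mul]; exact mul_le_mul (hS _) (tr _).2 (norm_nonneg _) hS0) (by ring)
  have h1 := (H.slopes_sub_le hCg0 hCg k).1
  have h2 := (H.slopes_sub_le hCg0 hCg (k - 1)).2
  have h3 := quot k
  have h4 := quot (k - 1)
  rw [sub_add_cancel] at h2 h4
  have e : G.laplace k (fun l => σ l * U l) + (q k - p k)
      = ((q k - (σ (k + 1) * a (k + 1) - σ k * b k) / (G.gapLen k : ℂ))
        + ((σ (k + 1) * a (k + 1) - σ k * b k) / (G.gapLen k : ℂ)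
          - (σ (k + 1) * U (k + 1) - σ k * U k) / (G.gapLen k : ℂ)))
        - ((p k - (σ k * a k - σ (k - 1) * b (k - 1)) / (G.gapLen (k - 1) : ℂ))
        + ((σ k * a k - σ (k - 1) * b (k - 1)) / (G.gapLen (k - 1) : ℂ)
          - (σ k * U k - σ (k - 1) * U (k - 1)) / (G.gapLen (k - 1) : ℂ))) := by
    rw [Chain.laplace_apply]; ring
  rw [e]
  refine (norm_sub_le _ _).trans ?_
  have h5 := norm_add_le (q k - (σ (k + 1) * a (k + 1) - σ k * b k) / (G.gapLen k : ℂ))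
    ((σ (k + 1) * a (k + 1) - σ k * b k) / (G.gapLen k : ℂ)
          - (σ (k + 1) * U (k + 1) - σ k * U k) / (G.gapLen k : ℂ))
  have h6 := norm_add_le (p k - (σ k * a k - σ (k - 1) * b (k - 1)) / (G.gapLen (k - 1) : ℂ))
    ((σ k * a k - σ (k - 1) * b (k - 1)) / (G.gapLen (k - 1) : ℂ)
          - (σ k * U k - σ (k - 1) * U (k - 1)) / (G.gapLen (k - 1) : ℂ))
  linarith

end Profile

/-! ### Bounds on the modulation in the high-contrast regime. -/

namespace Material

variable {P : Material N} {γ A : ℝ}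

theorem hasDerivAt_inv_κp (P : Material N) (i : Fin N) (t : ℝ) :
    HasDerivAt (fun τ => (((P.κp i τ)⁻¹ : ℝ) : ℂ))
      (∑ n ∈ Finset.Icc (-(P.M : ℤ)) P.M,
        P.kHat i n * (Complex.exp (Complex.I * n * P.Ω * t) * (Complex.I * n * P.Ω))) t := by
  simp only [P.inv_κp_eq]
  refine HasDerivAt.fun_sum fun n _ => HasDerivAt.const_mul _ (HasDerivAt.cexp ?_)
  simpa using (Complex.ofRealCLM.hasDerivAt (x := t)).const_mul (Complex.I * (n : ℂ) * P.Ω)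

theorem hasDerivAt_f (P : Material N) (t : ℝ) : HasDerivAt P.f (deriv P.f t) t :=
  ((P.f_contDiff.differentiable (by norm_num)) t).hasDerivAt

theorem norm_exp_mode (P : Material N) (n : ℤ) (t : ℝ) :
    ‖Complex.exp (Complex.I * n * P.Ω * t)‖ = 1 := by
  have h := norm_exp_I_mul (n * P.Ω) t
  rw [← h]
  push_cast
  ring_nf

namespace InRegime

theorem rpow_le_one (h : P.InRegime γ A) (hγ₁ : γ < 1) : P.δ ^ ((1 - γ) / 2) ≤ 1 :=
  Real.rpow_le_one P.δ_pos.le h.δ_lt_one.le (by linarith)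

theorem δ_le (h : P.InRegime γ A) (hγ₀ : 0 < γ) : P.δ ≤ P.δ ^ ((1 - γ) / 2) := by
  conv_lhs => rw [← Real.rpow_one P.δ]
  exact Real.rpow_le_rpow_of_exponent_ge P.δ_pos h.δ_lt_one.le (by linarith)

/-- The powers of `δ` combine to the positive exponent `(1 - γ)/2`, so even the highest modulation
frequency is bounded. This controls the derivative of `1/κ_i^p`. -/
theorem M_mul_Ω_le (h : P.InRegime γ A) (hγ₁ : γ < 1) (hA : 1 ≤ A) : P.M * P.Ω ≤ A ^ 2 := by
  have h1 : (P.M : ℝ) * P.Ω ≤ (A * P.δ ^ (-γ / 2)) * (A * P.δ ^ (1 / 2 : ℝ)) :=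
    mul_le_mul h.M_le h.Ω_le P.Ω_pos.le
      (mul_nonneg (by linarith) (Real.rpow_nonneg P.δ_pos.le _))
  have h2 : (A * P.δ ^ (-γ / 2)) * (A * P.δ ^ (1 / 2 : ℝ)) = A ^ 2 * P.δ ^ ((1 - γ) / 2) := by
    rw [show (1 - γ) / 2 = -γ / 2 + 1 / 2 by ring, Real.rpow_add P.δ_pos]
    ring
  rw [h2] at h1
  exact h1.trans (mul_le_of_le_one_right (by positivity) (h.rpow_le_one hγ₁))

theorem norm_inv_s_le (h : P.InRegime γ A) (i : Fin N) (t : ℝ) :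
    ‖(((P.s i t)⁻¹ : ℝ) : ℂ)‖ ≤ A := by
  rw [P.inv_s_eq]
  refine (norm_sum_le _ _).trans ((Finset.sum_le_sum fun n _ => ?_).trans (h.sHat_le i))
  rw [norm_mul, norm_exp_mode, mul_one]

theorem norm_invκ_le (h : P.InRegime γ A) (hA : 1 ≤ A) (i : Fin N) (t : ℝ) :
    ‖(P.invκ i t : ℂ)‖ ≤ A + A ^ 2 := by
  have h1 : ‖(((P.κp i t)⁻¹ : ℝ) : ℂ)‖ ≤ A := by
    rw [P.inv_κp_eq]
    refine (norm_sum_le _ _).trans ((Finset.sum_le_sum fun n _ => ?_).trans (h.kHat_le i))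
    rw [norm_mul, norm_exp_mode, mul_one]
  have h2 : ‖((P.c i * P.f t : ℝ) : ℂ)‖ ≤ A ^ 2 := by
    rw [Complex.norm_real, Real.norm_eq_abs, abs_mul, sq]
    exact mul_le_mul (h.c_le i) (h.f_le t) (abs_nonneg _) (by linarith)
  rw [invκ, Complex.ofReal_add]
  exact (norm_add_le _ _).trans (add_le_add h1 h2)

/-- `A ^ 3` comes from `Σ|k_{i,n}| ≤ A` times `|n| Ω ≤ M Ω ≤ A ^ 2`; `A ^ 2` comes from `c_i f'`. -/
theorem exists_hasDerivAt_invκ (h : P.InRegime γ A) (hγ₁ : γ < 1) (hA : 1 ≤ A) (i : Fin N)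
    (t : ℝ) : ∃ d : ℂ, HasDerivAt (fun τ => (P.invκ i τ : ℂ)) d t ∧ ‖d‖ ≤ A ^ 3 + A ^ 2 := by
  have hsum := (P.hasDerivAt_inv_κp i t).add (((P.hasDerivAt_f t).const_mul (P.c i)).ofReal_comp)
  refine ⟨_, hsum.congr_of_eventuallyEq (Eventually.of_forall fun τ => ?_), ?_⟩
  · simp [invκ]
  refine (norm_add_le _ _).trans (add_le_add ?_ ?_)
  · refine (norm_sum_le _ _).trans ?_
    have h1 : ∀ n ∈ Finset.Icc (-(P.M : ℤ)) P.M,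
        ‖P.kHat i n * (Complex.exp (Complex.I * n * P.Ω * t) * (Complex.I * n * P.Ω))‖
          ≤ ‖P.kHat i n‖ * A ^ 2 := by
      intro n hn
      rw [Finset.mem_Icc] at hn
      have h2 : |(n : ℝ)| ≤ P.M := by
        rw [abs_le]; exact ⟨by exact_mod_cast hn.1, by exact_mod_cast hn.2⟩
      have h3 : ‖Complex.I * n * (P.Ω : ℂ)‖ = |(n : ℝ)| * P.Ω := by
        rw [norm_mul, norm_mul, Complex.norm_I, one_mul, Complex.norm_real,
          Real.norm_of_nonneg P.Ω_pos.le, Complex.norm_intCast]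
      rw [norm_mul, norm_mul, norm_exp_mode, one_mul, h3]
      exact mul_le_mul_of_nonneg_left
        ((mul_le_mul_of_nonneg_right h2 P.Ω_pos.le).trans (h.M_mul_Ω_le hγ₁ hA)) (norm_nonneg _)
    refine (Finset.sum_le_sum h1).trans ?_
    rw [← Finset.sum_mul]
    calc _ ≤ A * A ^ 2 := mul_le_mul_of_nonneg_right (h.kHat_le i) (by positivity)
      _ = A ^ 3 := by ring
  · rw [Complex.norm_real, Real.norm_eq_abs, abs_mul, sq]
    exact mul_le_mul (h.c_le i) (h.deriv_f_le t) (abs_nonneg _) (by linarith)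

theorem contrast_le (h : P.InRegime γ A) (m : ℤ) (i : Fin N) : P.contrast m i ≤ A * P.δ :=
  (div_le_iff₀ P.δ_pos).1 (h.contrast_mem m i).2

end InRegime

theorem matS_inv_mulVec (P : Material N) (t : ℝ) (x : Fin N → ℂ) :
    Matrix.mulVec (P.matS t)⁻¹ x = fun i => (((P.s i t)⁻¹ : ℝ) : ℂ) * x i := by
  have : (P.matS t)⁻¹ = Matrix.diagonal fun i => (((P.s i t)⁻¹ : ℝ) : ℂ) := by
    refine Matrix.inv_eq_right_inv ?_
    rw [matS, Matrix.diagonal_mul_diagonal, ← Matrix.diagonal_one]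
    congr 1; funext i
    rw [← Complex.ofReal_mul, mul_inv_cancel₀ (P.s_ne_zero i t), Complex.ofReal_one]
  funext i
  rw [this, Matrix.mulVec_diagonal]

theorem matK_inv_add_mulVec (P : Material N) (t : ℝ) (x : Fin N → ℂ) :
    Matrix.mulVec ((P.matK t)⁻¹ + P.matCt t) x = fun i => (P.invκ i t : ℂ) * x i := by
  have : (P.matK t)⁻¹ = Matrix.diagonal fun i => (((P.κp i t)⁻¹ : ℝ) : ℂ) := by
    refine Matrix.inv_eq_right_inv ?_
    rw [matK, Matrix.diagonal_mul_diagonal, ← Matrix.diagonal_one]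
    congr 1; funext i
    rw [← Complex.ofReal_mul, mul_inv_cancel₀ (P.κp_ne_zero i t), Complex.ofReal_one]
  funext i
  rw [this, matCt, Matrix.diagonal_add, Matrix.mulVec_diagonal, invκ, Complex.ofReal_add]

end Material
-- Time derivatives, resonator means and the wave equation.
variable {N : ℕ}

/-- The `k`-th time derivative of the field. -/
noncomputable def fieldDeriv (v : ℝ → ℝ → ℂ) (k : ℕ) (x t : ℝ) : ℂ :=
  field (fun x => freqMul k (v x)) x t

theorem fieldDeriv_zero (v : ℝ → ℝ → ℂ) : fieldDeriv v 0 = field v := by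
  funext x t; simp [fieldDeriv, field, freqMul_zero]

/-- The `k`-th time derivative of the averaged field in a resonator. -/
noncomputable def resDeriv (G : Chain N) (v : ℝ → ℝ → ℂ) (k : ℕ) (m : ℤ) (i : Fin N) (t : ℝ) : ℂ :=
  invFourier (freqMul k fun ω => resMode G v m ω i) t

theorem resField_eq (G : Chain N) (v : ℝ → ℝ → ℂ) (m : ℤ) (t : ℝ) (i : Fin N) :
    resField G v m t i = resDeriv G v 0 m i t := by
  simp [resField, resDeriv, freqMul_zero]

theorem freqMul_resMode (G : Chain N) (v : ℝ → ℝ → ℂ) (k : ℕ) (m : ℤ) (i : Fin N) :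
    (freqMul k fun ω => resMode G v m ω i)
      = fun ω => ((G.len i : ℝ) : ℂ)⁻¹ * ∫ x in G.D m i, freqMul k (v x) ω := by
  funext ω
  simp only [freqMul, resMode]
  rw [integral_const_mul]
  ring

theorem IsSubwavelength.integral_norm_le {P : Material N} {γ A : ℝ} {v : ℝ → ℝ → ℂ}
    (hs : IsSubwavelength P γ A v) {k : ℕ} (hk : k ≤ 2) (x : ℝ) :
    ∫ ω, ‖freqMul k (v x) ω‖ ≤ A * (P.δ ^ ((1 - γ) / 2)) ^ k := by
  simp only [norm_freqMul]
  exact hs x k hk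

theorem IsSubwavelength.norm_fieldDeriv_le {P : Material N} {γ A : ℝ} {v : ℝ → ℝ → ℂ}
    (hs : IsSubwavelength P γ A v) {k : ℕ} (hk : k ≤ 2) (x t : ℝ) :
    ‖fieldDeriv v k x t‖ ≤ A * (P.δ ^ ((1 - γ) / 2)) ^ k :=
  (norm_invFourier_le _ t).trans (hs.integral_norm_le hk x)

namespace IsLocalisedSolution

variable {G : Chain N} {P : Material N} {v : ℝ → ℝ → ℂ} {γ A : ℝ}

theorem integrable_freqMul (hv : IsLocalisedSolution G P v) {k : ℕ} (hk : k ≤ 2) (x : ℝ) :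
    Integrable (freqMul k (v x)) := by
  rw [freqMul_eq]
  exact (hv.integrable x k hk).const_mul _

theorem measurable_freqMul (hv : IsLocalisedSolution G P v) (k : ℕ) :
    Measurable (Function.uncurry fun x => freqMul k (v x)) :=
  Measurable.mul (f := fun z : ℝ × ℝ => (Complex.I * (z.2 : ℂ)) ^ k) (by fun_prop) hv.measurable

theorem hasDerivAt_fieldDeriv (hv : IsLocalisedSolution G P v) {k : ℕ} (hk : k + 1 ≤ 2)
    (x t : ℝ) : HasDerivAt (fieldDeriv v k x) (fieldDeriv v (k + 1) x t) t :=
  hasDerivAt_invFourier (hv.integrable_freqMul (by omega) x) (hv.integrable_freqMul hk x) t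

theorem deriv_field (hv : IsLocalisedSolution G P v) (x : ℝ) :
    deriv (field v x) = fieldDeriv v 1 x := by
  rw [← fieldDeriv_zero]
  exact funext fun t => (hv.hasDerivAt_fieldDeriv (by norm_num) x t).deriv

theorem integrable_resMode (hv : IsLocalisedSolution G P v) (hs : IsSubwavelength P γ A v)
    {k : ℕ} (hk : k ≤ 2) (m : ℤ) (i : Fin N) :
    Integrable (freqMul k fun ω => resMode G v m ω i) := by
  rw [freqMul_resMode]
  exact (integrable_integral_Ioo (hv.measurable_freqMul k) (hv.integrable_freqMul hk)
    (hs.integral_norm_le hk)).const_mul _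

/-- Fubini: time derivatives of the averaged field are averages of the time derivatives. -/
theorem resDeriv_eq (hv : IsLocalisedSolution G P v) (hs : IsSubwavelength P γ A v)
    {k : ℕ} (hk : k ≤ 2) (m : ℤ) (i : Fin N) (t : ℝ) :
    resDeriv G v k m i t = ((G.len i : ℝ) : ℂ)⁻¹ * ∫ x in G.D m i, fieldDeriv v k x t := by
  have h := invFourier_integral_Ioo (a := G.xm (idx m i)) (b := G.xp (idx m i))
    (hv.measurable_freqMul k) (hv.integrable_freqMul hk) (hs.integral_norm_le hk) t
  simp only [resDeriv, freqMul_resMode, fieldDeriv, Chain.D, ← h, invFourier, mul_assoc]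
  rw [integral_const_mul]

theorem hasDerivAt_resDeriv (hv : IsLocalisedSolution G P v) (hs : IsSubwavelength P γ A v)
    {k : ℕ} (hk : k + 1 ≤ 2) (m : ℤ) (i : Fin N) (t : ℝ) :
    HasDerivAt (resDeriv G v k m i) (resDeriv G v (k + 1) m i t) t :=
  hasDerivAt_invFourier (hv.integrable_resMode hs (by omega) m i) (hv.integrable_resMode hs hk m i) t

theorem hasDerivAt_resField (hv : IsLocalisedSolution G P v) (hs : IsSubwavelength P γ A v)
    (m : ℤ) (t : ℝ) : HasDerivAt (resField G v m) (fun i => resDeriv G v 1 m i t) t := by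
  rw [hasDerivAt_pi]
  intro i
  simp only [resField_eq]
  exact hv.hasDerivAt_resDeriv hs (by norm_num) m i t

theorem integrableOn_fieldDeriv (hv : IsLocalisedSolution G P v) (hs : IsSubwavelength P γ A v)
    {k : ℕ} (hk : k ≤ 2) (m : ℤ) (i : Fin N) (t : ℝ) :
    IntegrableOn (fun x => fieldDeriv v k x t) (G.D m i) :=
  Measure.integrableOn_of_bounded (by simp [Chain.D])
    (stronglyMeasurable_field (hv.measurable_freqMul k) t).aestronglyMeasurable
    (Eventually.of_forall fun x => hs.norm_fieldDeriv_le hk x t)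

/-- The average of the field is close to the field where this oscillates little. -/
theorem norm_field_sub_resField_le (hv : IsLocalisedSolution G P v)
    (hs : IsSubwavelength P γ A v) {m : ℤ} {i : Fin N} {t R : ℝ}
    (hR : ∀ x ∈ G.D m i, ∀ y ∈ G.D m i, ‖field v y t - field v x t‖ ≤ R) {x : ℝ}
    (hx : x ∈ G.D m i) : ‖field v x t - resField G v m t i‖ ≤ R := by
  have hl := G.len_pos i
  have hne : ((G.len i : ℝ) : ℂ) ≠ 0 := by exact_mod_cast hl.ne'
  have hvol : volume.real (G.D m i) = G.len i := by
    rw [Chain.D, Real.volume_real_Ioo_of_le (G.xm_lt_xp _).le, G.len_eq m i]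
  have hfin : volume (G.D m i) < ⊤ := by simp [Chain.D]
  have hint := hv.integrableOn_fieldDeriv hs (k := 0) (by norm_num) m i t
  have e : field v x t - resField G v m t i
      = ((G.len i : ℝ) : ℂ)⁻¹ * ∫ y in G.D m i, (field v x t - fieldDeriv v 0 y t) := by
    rw [integral_sub (integrableOn_const (C := field v x t) hfin.ne) hint, setIntegral_const, hvol,
      resField_eq, hv.resDeriv_eq hs (by norm_num), Complex.real_smul, mul_sub, inv_mul_cancel_left₀ hne]
  rw [e, norm_mul, norm_inv, Complex.norm_real, Real.norm_of_nonneg hl.le,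
    inv_mul_le_iff₀ hl, ← hvol, mul_comm]
  refine norm_setIntegral_le_of_norm_le_const hfin fun y hy => ?_
  rw [fieldDeriv_zero]
  exact hR y hy x hx

theorem wave_in_expanded (hv : IsLocalisedSolution G P v) {t : ℝ} {m : ℤ} {i : Fin N} {d : ℂ}
    (hd : HasDerivAt (fun τ => (P.invκ i τ : ℂ)) d t) {x : ℝ} (hx : x ∈ G.D m i) :
    (P.vd m i : ℂ) ^ 2 * deriv (deriv fun y => field v y t) x
      = d * fieldDeriv v 1 x t + (P.invκ i t : ℂ) * fieldDeriv v 2 x t := by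
  have h := hv.wave_in t m i x hx
  rw [hv.deriv_field, (hd.fun_mul (hv.hasDerivAt_fieldDeriv (k := 1) le_rfl x t)).deriv,
    sub_eq_zero] at h
  exact h.symm

/-- The traces and slopes of the field at a fixed time. -/
theorem exists_profile [NeZero N] (hv : IsLocalisedSolution G P v) (t : ℝ) :
    ∃ a b p q : ℤ → ℂ, Profile G (fun x => field v x t)
      (fun l => (((P.s (resIdx N l) t)⁻¹ : ℝ) : ℂ))
      (fun l => ((P.s (resIdx N l) t * P.contrast (l / N) (resIdx N l) : ℝ) : ℂ)) a b p q := by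
  have h1 := fun l : ℤ => hv.trace_left t (l / N) (resIdx N l)
  have h2 := fun l : ℤ => hv.trace_right t (l / N) (resIdx N l)
  have h3 := fun l : ℤ => hv.flux_left t (l / N) (resIdx N l)
  have h4 := fun l : ℤ => hv.flux_right t (l / N) (resIdx N l)
  simp only [idx_resIdx, JumpLeft, JumpRight, one_mul] at h1 h2 h3 h4
  choose ao a hao hai ha using h1
  choose bo b hbo hbi hb using h2
  choose p pin hpo hpi hp using h3
  choose q qin hqo hqi hq using h4
  -- The flux condition is solved for the inner slope; its factor `s_i δ_i^m` is the small `τ` of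
  -- the profile.
  have inner : ∀ (l : ℤ) (x y : ℂ),
      (P.contrast (l / N) (resIdx N l) : ℂ) * x = (((P.s (resIdx N l) t)⁻¹ : ℝ) : ℂ) * y →
      ((P.s (resIdx N l) t * P.contrast (l / N) (resIdx N l) : ℝ) : ℂ) * x = y := by
    intro l x y h
    have hne : (P.s (resIdx N l) t : ℂ) ≠ 0 := by exact_mod_cast P.s_ne_zero _ t
    rw [Complex.ofReal_mul, mul_assoc, h, Complex.ofReal_inv, mul_inv_cancel_left₀ hne]
  refine ⟨a, b, p, q, hv.smooth_out t, fun l => ?_, fun l => ha l ▸ hao l, hai,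
    fun l => hb l ▸ hbo l, hbi, hpo, fun l => ?_, hqo, fun l => ?_⟩
  · have := hv.smooth_in t (l / N) (resIdx N l)
    rwa [Chain.D, idx_resIdx] at this
  · rw [inner l _ _ (hp l)]; exact hpi l
  · rw [inner l _ _ (hq l)]; exact hqi l

/-- `A ^ 2` bounds `v_0⁻²`, and the second moment gives `A ε²`, weakened to `A ε` to match the bound
in the resonators. -/
theorem norm_deriv_deriv_gap_le (hv : IsLocalisedSolution G P v) (hP : P.InRegime γ A)
    (hγ₁ : γ < 1) (hA : 1 ≤ A) (hs : IsSubwavelength P γ A v) (t : ℝ) (k : ℤ) {x : ℝ}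
    (hx : x ∈ G.gap k) :
    ‖deriv (deriv fun y => field v y t) x‖ ≤ A ^ 3 * P.δ ^ ((1 - γ) / 2) := by
  have h := hv.wave_out t k x hx
  rw [hv.deriv_field, (hv.hasDerivAt_fieldDeriv (k := 1) le_rfl x t).deriv, sub_eq_zero] at h
  have h2 := hs.norm_fieldDeriv_le le_rfl x t
  have he := hP.rpow_le_one hγ₁
  have he0 : 0 < P.δ ^ ((1 - γ) / 2) := Real.rpow_pos_of_pos P.δ_pos _
  generalize P.δ ^ ((1 - γ) / 2) = e at *
  have hA0 : 0 < A := by linarith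
  have hv0 : 1 ≤ A * P.v0 := by
    have := mul_le_mul_of_nonneg_left hP.v0_mem.1 hA0.le
    rwa [mul_inv_cancel₀ hA0.ne'] at this
  have h3 : ‖fieldDeriv v (1 + 1) x t‖ = P.v0 ^ 2 * ‖deriv (deriv fun y => field v y t) x‖ := by
    rw [h, norm_mul, norm_pow, Complex.norm_real, Real.norm_eq_abs, sq_abs]
  rw [h3] at h2
  calc ‖deriv (deriv fun y => field v y t) x‖
      ≤ (A * P.v0) ^ 2 * ‖deriv (deriv fun y => field v y t) x‖ :=
        le_mul_of_one_le_left (norm_nonneg _) (one_le_pow₀ hv0)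
    _ = A ^ 2 * (P.v0 ^ 2 * ‖deriv (deriv fun y => field v y t) x‖) := by ring
    _ ≤ A ^ 2 * (A * e ^ 2) := by gcongr
    _ = A ^ 3 * (e * e) := by ring
    _ ≤ A ^ 3 * e := by gcongr; exact mul_le_of_le_one_left he0.le he

/-- The term with the derivative of `1/κ_i` contains only `∂ₜu`, of order `ε`; hence one power of
`ε` instead of two. -/
theorem norm_deriv_deriv_resonator_le (hv : IsLocalisedSolution G P v) (hP : P.InRegime γ A)
    (hγ₁ : γ < 1) (hA : 1 ≤ A) (hs : IsSubwavelength P γ A v) (t : ℝ) (m : ℤ) (i : Fin N) {x : ℝ}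
    (hx : x ∈ G.D m i) : ‖deriv (deriv fun y => field v y t) x‖
      ≤ A ^ 3 * (A ^ 3 + 2 * A ^ 2 + A) * P.δ ^ ((1 - γ) / 2) := by
  obtain ⟨d, hd, hdA⟩ := hP.exists_hasDerivAt_invκ hγ₁ hA i t
  have h := hv.wave_in_expanded hd hx
  have h1 := hs.norm_fieldDeriv_le (k := 1) (by norm_num) x t
  have h2 := hs.norm_fieldDeriv_le le_rfl x t
  have hk := hP.norm_invκ_le hA i t
  have he := hP.rpow_le_one hγ₁
  have he0 : 0 < P.δ ^ ((1 - γ) / 2) := Real.rpow_pos_of_pos P.δ_pos _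
  generalize P.δ ^ ((1 - γ) / 2) = e at *
  have hA0 : 0 < A := by linarith
  rw [pow_one] at h1
  have h2' : ‖fieldDeriv v 2 x t‖ ≤ A * e := by
    refine h2.trans (mul_le_mul_of_nonneg_left ?_ hA0.le)
    rw [sq]; exact mul_le_of_le_one_left he0.le he
  have hvd : 1 ≤ A * P.vd m i := by
    have := mul_le_mul_of_nonneg_left (hP.vd_mem m i).1 hA0.le
    rwa [mul_inv_cancel₀ hA0.ne'] at this
  have h3 : P.vd m i ^ 2 * ‖deriv (deriv fun y => field v y t) x‖
      ≤ (A ^ 3 + A ^ 2) * (A * e) + (A + A ^ 2) * (A * e) := by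
    have e1 : P.vd m i ^ 2 * ‖deriv (deriv fun y => field v y t) x‖
        = ‖(P.vd m i : ℂ) ^ 2 * deriv (deriv fun y => field v y t) x‖ := by
      rw [norm_mul, norm_pow, Complex.norm_real, Real.norm_eq_abs, sq_abs]
    rw [e1, h]
    refine (norm_add_le _ _).trans ?_
    rw [norm_mul, norm_mul]
    gcongr
  calc ‖deriv (deriv fun y => field v y t) x‖
      ≤ (A * P.vd m i) ^ 2 * ‖deriv (deriv fun y => field v y t) x‖ :=
        le_mul_of_one_le_left (norm_nonneg _) (one_le_pow₀ hvd)
    _ = A ^ 2 * (P.vd m i ^ 2 * ‖deriv (deriv fun y => field v y t) x‖) := by ring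
    _ ≤ A ^ 2 * ((A ^ 3 + A ^ 2) * (A * e) + (A + A ^ 2) * (A * e)) := by gcongr
    _ = A ^ 3 * (A ^ 3 + 2 * A ^ 2 + A) * e := by ring

/-- The wave equation averaged over a resonator. -/
theorem averaged_wave_in (hv : IsLocalisedSolution G P v) (hs : IsSubwavelength P γ A v)
    {t : ℝ} {m : ℤ} {i : Fin N} {d y z : ℂ}
    (hd : HasDerivAt (fun τ => (P.invκ i τ : ℂ)) d t)
    (hy : Tendsto (deriv fun x => field v x t) (𝓝[>] (G.xm (idx m i))) (𝓝 y))
    (hz : Tendsto (deriv fun x => field v x t) (𝓝[<] (G.xp (idx m i))) (𝓝 z)) :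
    d * resDeriv G v 1 m i t + (P.invκ i t : ℂ) * resDeriv G v 2 m i t
      = (P.vd m i : ℂ) ^ 2 / ((G.len i : ℝ) : ℂ) * (z - y) := by
  have hlt := G.xm_lt_xp (idx m i)
  have hvd1 : (P.vd m i : ℂ) ≠ 0 := by
    exact_mod_cast (Real.sqrt_pos.2 (div_pos P.κr_pos (P.ρd_pos m i))).ne'
  have hvd : (P.vd m i : ℂ) ^ 2 ≠ 0 := pow_ne_zero 2 hvd1
  have hi1 := hv.integrableOn_fieldDeriv hs (k := 1) (by norm_num) m i t
  have hi2 := hv.integrableOn_fieldDeriv hs (k := 2) (by norm_num) m i t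
  have hi : IntegrableOn (fun x => ((P.vd m i : ℂ) ^ 2)⁻¹ *
      (d * fieldDeriv v 1 x t + (P.invκ i t : ℂ) * fieldDeriv v 2 x t)) (G.D m i) :=
    ((hi1.const_mul d).add (hi2.const_mul _)).const_mul _
  have hder : ∀ x ∈ Set.Ioo (G.xm (idx m i)) (G.xp (idx m i)),
      HasDerivAt (deriv fun x => field v x t) (((P.vd m i : ℂ) ^ 2)⁻¹ *
        (d * fieldDeriv v 1 x t + (P.invκ i t : ℂ) * fieldDeriv v 2 x t)) x := by
    intro x hx
    rw [← hv.wave_in_expanded hd hx, inv_mul_cancel_left₀ hvd]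
    exact (differentiableAt_deriv_of_contDiffOn_Ioo (hv.smooth_in t m i) hx).hasDerivAt
  -- The fundamental theorem of calculus with one-sided limits, since the slope need not extend
  -- continuously through the ends.
  have hint := intervalIntegral.integral_eq_sub_of_hasDerivAt_of_tendsto hlt hder
    ((intervalIntegrable_iff_integrableOn_Ioo_of_le hlt.le).2 hi) hy hz
  rw [intervalIntegral.integral_of_le hlt.le, integral_Ioc_eq_integral_Ioo,
    ← Chain.D, integral_const_mul, integral_add (hi1.const_mul d) (hi2.const_mul _),
    integral_const_mul, integral_const_mul] at hint
  rw [hv.resDeriv_eq hs (by norm_num), hv.resDeriv_eq hs (by norm_num), ← hint]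
  field_simp

end IsLocalisedSolution

end SpaceTime

/-! ### Assembly of the estimates. -/

open SpaceTime in
theorem mainTheorem3 {N : ℕ} (G : SpaceTime.Chain N) (γ A : ℝ) (hγ₀ : 0 < γ) (hγ₁ : γ < 1)
    (hA : 1 ≤ A) :
    ∃ K : ℝ, 0 < K ∧
      ∀ (P : SpaceTime.Material N), P.InRegime γ A →
      ∀ (v : ℝ → ℝ → ℂ), SpaceTime.IsLocalisedSolution G P v →
        SpaceTime.IsSubwavelength P γ A v →
      ∀ (m : ℤ) (t : ℝ),
        (∀ i, ∀ x ∈ G.D m i,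
          ‖SpaceTime.field v x t - SpaceTime.resField G v m t i‖ ≤ K * P.δ ^ ((1 - γ) / 2)) ∧
        DifferentiableAt ℝ (SpaceTime.resField G v m) t ∧
        DifferentiableAt ℝ (fun τ => Matrix.mulVec ((P.matK τ)⁻¹ + P.matCt τ)
          (deriv (SpaceTime.resField G v m) τ)) t ∧
        (Summable fun n : ℤ => Matrix.mulVec (P.realCap G (n - m))
          (Matrix.mulVec (P.matS t)⁻¹ (SpaceTime.resField G v n t))) ∧
        ‖Matrix.mulVec (P.matB m) (∑' n : ℤ, Matrix.mulVec (P.realCap G (n - m))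
            (Matrix.mulVec (P.matS t)⁻¹ (SpaceTime.resField G v n t)))
          + Matrix.mulVec (P.matS t)⁻¹
            (deriv (fun τ => Matrix.mulVec ((P.matK τ)⁻¹ + P.matCt τ)
              (deriv (SpaceTime.resField G v m) τ)) t)‖
          ≤ K * P.δ ^ (1 + (1 - γ) / 2) := by
  have : NeZero N := G.neZero
  obtain ⟨g, hg, hgap⟩ := G.exists_pos_le_gapLen
  obtain ⟨l₀, hl₀, hlen⟩ := G.exists_pos_le_len
  have hA0 : 0 < A := by linarith
  have hL := G.L_pos
  -- Up to powers of `ε` and `δ`, `K₁` bounds the outer slopes, `K₂` the second derivative in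
  -- resonators, `K₃` the oscillation over a resonator and `K₄` the final residual.
  set K₁ : ℝ := 2 * (A * A) / g + A ^ 3 * G.L with hK₁
  set K₂ : ℝ := A ^ 3 * (A ^ 3 + 2 * A ^ 2 + A) with hK₂
  set K₃ : ℝ := (A ^ 2 * K₁ + K₂ * G.L) * G.L with hK₃
  set K₄ : ℝ := A ^ 3 / l₀ * (2 * (A ^ 3 * G.L + 2 * (A * K₃) / g)) with hK₄
  have hK₁0 : 0 < K₁ := by positivity
  have hK₂0 : 0 < K₂ := by positivity
  have hK₃0 : 0 < K₃ := by positivity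
  have hK₄0 : 0 < K₄ := by positivity
  refine ⟨K₃ + K₄, by positivity, fun P hP v hv hs m t => ?_⟩
  have he1 := hP.rpow_le_one hγ₁
  have hδe := hP.δ_le hγ₀
  have he0 : 0 < P.δ ^ ((1 - γ) / 2) := Real.rpow_pos_of_pos P.δ_pos _
  have hδ := P.δ_pos
  have hexp : P.δ ^ (1 + (1 - γ) / 2) = P.δ * P.δ ^ ((1 - γ) / 2) := by
    rw [Real.rpow_add hδ, Real.rpow_one]
  have hCg := fun k x => hv.norm_deriv_deriv_gap_le hP hγ₁ hA hs t k (x := x)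
  have hCr := fun m i x => hv.norm_deriv_deriv_resonator_le hP hγ₁ hA hs t m i (x := x)
  have hu : ∀ x, ‖field v x t‖ ≤ A := fun x => by
    simpa [fieldDeriv_zero] using hs.norm_fieldDeriv_le (k := 0) (by norm_num) x t
  rw [hexp]
  set e := P.δ ^ ((1 - γ) / 2) with he
  obtain ⟨a, b, p, q, H⟩ := hv.exists_profile t
  have hS : ∀ l : ℤ, ‖(((P.s (resIdx N l) t)⁻¹ : ℝ) : ℂ)‖ ≤ A :=
    fun l => hP.norm_inv_s_le (resIdx N l) t
  have hosc : ∀ (n : ℤ) (i : Fin N), ∀ x ∈ G.D n i,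
      ‖field v x t - resField G v n t i‖ ≤ K₃ * e := by
    intro n i x hx
    refine hv.norm_field_sub_resField_le hs (fun x hx y hy => ?_) hx
    -- High contrast enters here: inner slopes carry a factor `O(δ)`, and `δ ≤ ε`.
    have hT : ‖((P.s (resIdx N (idx n i)) t *
        P.contrast (idx n i / N) (resIdx N (idx n i)) : ℝ) : ℂ)‖ ≤ A ^ 2 * e := by
      rw [resIdx_idx, idx_ediv, Complex.norm_real, norm_mul, Real.norm_eq_abs,
        Real.norm_of_nonneg (P.contrast_pos n i).le]
      calc |P.s i t| * P.contrast n i ≤ A * (A * P.δ) :=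
            mul_le_mul (hP.s_le i t) (hP.contrast_le n i) (P.contrast_pos n i).le hA0.le
        _ ≤ A * (A * e) := by gcongr
        _ = A ^ 2 * e := by ring
    have h := H.norm_sub_le_of_mem hg hgap (by positivity) (by positivity) hCg
      ((G.len_eq n i).symm.le.trans (G.len_le i)) (hCr n i) hu hS hT hx hy
    refine h.trans ?_
    have h1 : A ^ 3 * e * G.L ≤ A ^ 3 * G.L := by
      rw [mul_right_comm]; exact mul_le_of_le_one_right (by positivity) he1
    calc _ ≤ (A ^ 2 * e * K₁ + K₂ * e * G.L) * G.L := by rw [hK₁]; gcongr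
      _ = K₃ * e := by rw [hK₃]; ring
  have hres : ∀ τ, deriv (resField G v m) τ = fun i => resDeriv G v 1 m i τ :=
    fun τ => (hv.hasDerivAt_resField hs m τ).deriv
  choose d hd _ using fun i => hP.exists_hasDerivAt_invκ hγ₁ hA i t
  have hmom : HasDerivAt (fun τ => Matrix.mulVec ((P.matK τ)⁻¹ + P.matCt τ)
      (deriv (resField G v m) τ))
      (fun i => d i * resDeriv G v 1 m i t + (P.invκ i t : ℂ) * resDeriv G v 2 m i t) t := by
    simp only [hres, P.matK_inv_add_mulVec]
    rw [hasDerivAt_pi]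
    exact fun i => (hd i).mul (hv.hasDerivAt_resDeriv hs le_rfl m i t)
  have hsum := P.hasSum_realCap G m fun n => Matrix.mulVec (P.matS t)⁻¹ (resField G v n t)
  refine ⟨fun i x hx => (hosc m i x hx).trans ?_, (hv.hasDerivAt_resField hs m t).differentiableAt,
    hmom.differentiableAt, hsum.summable, ?_⟩
  · gcongr; linarith
  rw [hsum.tsum_eq, hmom.deriv]
  refine (pi_norm_le_iff_of_nonneg (by positivity)).2 fun i => ?_
  have hlap := H.norm_laplace_add_le (R := K₃ * e) hg hgap (by positivity) hCg hS
    (U := fun l => resField G v (l / N) t (resIdx N l)) (fun l x hx => by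
      refine hosc (l / N) (resIdx N l) x ?_
      rwa [Chain.D, idx_resIdx]) (idx m i)
  have hwave := hv.averaged_wave_in hs (hd i) (H.left_slope_in (idx m i))
    (H.right_slope_in (idx m i))
  rw [resIdx_idx, idx_ediv] at hwave
  have hsne : (P.s i t : ℂ) ≠ 0 := by exact_mod_cast P.s_ne_zero i t
  have hlpos := G.len_pos i
  have hlne : ((G.len i : ℝ) : ℂ) ≠ 0 := by exact_mod_cast hlpos.ne'
  have hvr : 0 < P.vr := Real.sqrt_pos.2 (div_pos P.κr_pos P.ρr_pos)
  -- The weight `b_i^m` turns the prefactor `δ v_r²` of `𝒞` into the local `δ_i^m (v_i^m)²`.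
  have hb : ((P.b m i : ℝ) : ℂ) * ((P.δ * P.vr ^ 2 / G.len i : ℝ) : ℂ)
      = ((P.contrast m i * P.vd m i ^ 2 / G.len i : ℝ) : ℂ) := by
    rw [← Complex.ofReal_mul, Material.b]
    congr 1
    field_simp
  rw [Pi.add_apply, P.matS_inv_mulVec, Material.matB, Matrix.mulVec_diagonal]
  beta_reduce
  rw [hwave, ← mul_assoc, hb]
  simp only [P.matS_inv_mulVec]
  -- `S⁻¹` cancels the factor `s_i` of the inner slopes, so both terms share one coefficient of
  -- order `δ`, and what remains is the quantity bounded in `hlap`.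
  have hcomb : ∀ X : ℂ, ((P.contrast m i * P.vd m i ^ 2 / G.len i : ℝ) : ℂ) * X
      + (((P.s i t)⁻¹ : ℝ) : ℂ) * ((P.vd m i : ℂ) ^ 2 / ((G.len i : ℝ) : ℂ) *
        (((P.s i t * P.contrast m i : ℝ) : ℂ) * q (idx m i)
          - ((P.s i t * P.contrast m i : ℝ) : ℂ) * p (idx m i)))
      = ((P.contrast m i * P.vd m i ^ 2 / G.len i : ℝ) : ℂ) *
        (X + (q (idx m i) - p (idx m i))) := by
    intro X
    push_cast
    field_simp
  rw [hcomb, norm_mul, Complex.norm_real, Real.norm_of_nonneg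
    (div_nonneg (mul_nonneg (P.contrast_pos m i).le (sq_nonneg _)) hlpos.le)]
  have hvd0 : 0 ≤ P.vd m i := Real.sqrt_nonneg _
  have hcoef : P.contrast m i * P.vd m i ^ 2 / G.len i ≤ A ^ 3 / l₀ * P.δ := by
    have h1 : P.contrast m i * P.vd m i ^ 2 ≤ (A * P.δ) * A ^ 2 :=
      mul_le_mul (hP.contrast_le m i) (pow_le_pow_left₀ hvd0 (hP.vd_mem m i).2 2)
        (sq_nonneg _) (by positivity)
    calc P.contrast m i * P.vd m i ^ 2 / G.len i ≤ (A * P.δ) * A ^ 2 / l₀ :=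
          div_le_div₀ (by positivity) h1 hl₀ (hlen i)
      _ = A ^ 3 / l₀ * P.δ := by ring
  calc _ ≤ (A ^ 3 / l₀ * P.δ) * (2 * (A ^ 3 * e * G.L + 2 * (A * (K₃ * e)) / g)) :=
        mul_le_mul hcoef hlap (norm_nonneg _) (by positivity)
    _ = K₄ * (P.δ * e) := by rw [hK₄]; ring
    _ ≤ (K₃ + K₄) * (P.δ * e) := by gcongr; linarith
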